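/- Let $G$ be a finite simple graph with vertex set $V$, $n=|V|$, and let $X_G=\sum_{\kappa}\prod_{v\in V}x_{\kappa(v)}$ be Stanley's chromatic symmetric function, the sum being over all proper colorings $\kappa:V\to\{1,2,3,\dots\}$ (maps with $\kappa(u)\ne\kappa(v)$ whenever $u,v$ are adjacent). Then $X_G$ has a unique expansion $X_G=\sum_{\lambda}c_\lambda s_\lambda$ as a finite integer linear combination of Schur functions $s_\lambda=\sum_{T\in SSYT(\lambda)}x^{\mathrm{weight}(T)}$. For $j\ge 0$ let $a_j$ be the number of acyclic orientations of $G$ with exactly $j$ sinks (a sink is a vertex with no arrow pointing away from it; an isolated vertex is a sink). For $1\le k\le n$ let $\lambda^{(k)}=(k,1,\dots,1)$ be the hook partition of $n$ with first part $k$ and $n-k$ further parts equal to $1$. Then for every $1\le k\le n$, $$c_{\lambda^{(k)}}=\sum_{j=1}^{n}\binom{j-1}{k-1}\,a_j .$$ In particular, for every finite simple graph, each coefficient $c_\lambda$ with $\lambda$ a hook $(k,1,\dots,1)$ is nonnegative. -/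

import Mathlib

namespace ChromaticHook

noncomputable section

/-! Symmetric functions live in the formal power series in countably many commuting
variables.  The variables are indexed by `ℕ`, the index `i` standing for `x_{i+1}`;
accordingly colours and tableau entries start at `0`. -/

/-- The exponent vector of `x_κ = ∏ v, x_{κ v}`. -/
def colorWeight {V : Type*} [Fintype V] (κ : V → ℕ) : ℕ →₀ ℕ :=
  ∑ v, Finsupp.single (κ v) 1

/-- Only finitely many maps `κ : V → ℕ` have a given exponent vector. -/
theorem finite_colorWeight {V : Type*} [Fintype V] (d : ℕ →₀ ℕ) :
    {κ : V → ℕ | colorWeight κ = d}.Finite := by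
  refine (Set.Finite.pi' (fun _ : V => d.support.finite_toSet)).subset ?_
  rintro κ rfl v
  simp only [SetLike.mem_coe, Finsupp.mem_support_iff, colorWeight, Finsupp.finsetSum_apply]
  have h : (Finsupp.single (κ v) 1 : ℕ →₀ ℕ) (κ v)
      ≤ ∑ w, (Finsupp.single (κ w) 1 : ℕ →₀ ℕ) (κ v) :=
    Finset.single_le_sum (f := fun w => (Finsupp.single (κ w) 1 : ℕ →₀ ℕ) (κ v))
      (fun _ _ => Nat.zero_le _) (Finset.mem_univ v)
  rw [Finsupp.single_eq_same] at h
  omega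

/-- The chromatic symmetric function `X_G = ∑ κ, x_κ`, the sum being over all proper colourings
`κ`: the coefficient of `x^d` is the (finite) number of proper colourings with `x_κ = x^d`. -/
def chromaticSymm {V : Type*} [Fintype V] (G : SimpleGraph V) : MvPowerSeries ℕ ℤ :=
  fun d => (Nat.card {κ : G.Coloring ℕ // colorWeight (fun v => κ v) = d} : ℤ)

/-- The exponent vector of the monomial `x^{weight T}` of a semistandard tableau. -/
def tableauWeight {μ : YoungDiagram} (T : SemistandardYoungTableau μ) : ℕ →₀ ℕ :=
  ∑ b ∈ μ.cells, Finsupp.single (T b.1 b.2) 1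

/-- Only finitely many semistandard tableaux of a given shape have a given weight. -/
theorem finite_tableauWeight (μ : YoungDiagram) (d : ℕ →₀ ℕ) :
    {T : SemistandardYoungTableau μ | tableauWeight T = d}.Finite := by
  let F : SemistandardYoungTableau μ → (μ.cells → ℕ) := fun T b => T b.1.1 b.1.2
  have hF : Function.Injective F := by
    intro S T h
    ext i j
    by_cases hb : (i, j) ∈ μ
    · exact congrFun h ⟨(i, j), hb⟩
    · rw [S.zeros hb, T.zeros hb]
  refine ((finite_colorWeight d).preimage hF.injOn).subset ?_
  rintro T rfl
  exact Finset.sum_coe_sort μ.cells (fun b => (Finsupp.single (T b.1 b.2) 1 : ℕ →₀ ℕ))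

/-- The Schur function `s_μ = ∑ T, x^{weight T}`, the sum being over all semistandard tableaux `T`
of shape `μ`: the coefficient of `x^d` is the (finite) number of those of weight `d`. -/
def schur (μ : YoungDiagram) : MvPowerSeries ℕ ℤ :=
  fun d => (Nat.card {T : SemistandardYoungTableau μ // tableauWeight T = d} : ℤ)

/-- `f = ∑ μ, c_μ s_μ`, with finitely many nonzero coefficients. -/
def IsSchurExpansion (f : MvPowerSeries ℕ ℤ) (c : YoungDiagram →₀ ℤ) : Prop :=
  f = c.sum fun μ a => a • schur μ

/-- The hook `(k, 1, …, 1)` with `m` ones after its first part `k ≥ 1`. -/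
def hook (k m : ℕ) (hk : 1 ≤ k) : YoungDiagram :=
  YoungDiagram.ofRowLens (k :: List.replicate m 1) (by
    rw [List.sortedGE_iff_pairwise, List.pairwise_cons]
    refine ⟨fun a ha => ?_, ?_⟩
    · rw [List.eq_of_mem_replicate ha]; exact hk
    · exact List.pairwise_replicate.2 (Or.inr le_rfl))

/-- `D` is an orientation of `G`: each edge of `G` becomes an arrow in exactly one of its two
directions, and there are no other arrows. -/
def IsOrientation {V : Type*} (G : SimpleGraph V) (D : Digraph V) : Prop :=
  (∀ u v, D.Adj u v → G.Adj u v) ∧ ∀ u v, G.Adj u v → Xor (D.Adj u v) (D.Adj v u)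

/-- There is no directed cycle (closed directed walk of positive length). -/
def IsAcyclic {V : Type*} (D : Digraph V) : Prop :=
  ∀ v, ¬ Relation.TransGen D.Adj v v

/-- The set of sinks: vertices with no arrow pointing away from them. -/
def sinks {V : Type*} (D : Digraph V) : Set V :=
  {v | ∀ w, ¬ D.Adj v w}

/-- `a_j`: the number of acyclic orientations of `G` with exactly `j` sinks. -/
def numAcyclic {V : Type*} (G : SimpleGraph V) (j : ℕ) : ℕ :=
  Nat.card {D : Digraph V // IsOrientation G D ∧ IsAcyclic D ∧ (sinks D).ncard = j}

end

end ChromaticHook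

namespace ChromaticHook

noncomputable section

/-! The coefficient of a monomial in a symmetric function `f` is its pairing with a product of
complete homogeneous functions `h`. Since `e_N` is the sum of `(-1)^(N - length l) h_l` over
compositions `l` of `N`, the expression `alternating N (fun l => g (l ++ [k]))`, with `g` the
coefficients of `f`, is the pairing of `f` with `e_N h_k`. By Pieri's rule `e_N h_k` is the sum of
the Schur functions of the hooks `(k, 1^N)` and `(k+1, 1^(N-1))` (only the first if `N = 0`). So on
`X_G`, with `N = n - k`, the functional yields the sum of two consecutive hook coefficients. On the
other hand it counts acyclic orientations of `G` with `k` marked sinks, that is, it equals the sum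
of `(j choose k) a_j`. Pascal's rule and descent from `k = n + 1` then separate the two coefficients
(`coeff_hook_add_coeff_hook`, `coeff_hook_eq`). Both evaluations are instances of one argument. A
coefficient of `s_μ` counts ways to peel horizontal strips off `μ`; a coefficient of `X_G` counts
ways to peel stable sets off `V`. `StripSystem.alternating_count` evaluates the functional for any
such peeling, once a candidate value is known to be killed by signed removal of one strip. The
cancellation toggles a cell for diagrams (`sum_hookIndicator`) and is inclusion-exclusion over sinks
for graphs (`sum_removeStable_sinkPairs`). Existence and uniqueness of the expansion follow from the
symmetry of the counts (`StripSystem.count_perm`) and the unitriangularity of the Kostka matrix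
(`det_kostka`). -/

/-! ### Strip removal and the symmetry of its counts. -/

/-- Combinatorial objects from which strips can be removed, `strips x` being what can be left of
`x`.  The involution `flip x · z` exchanges the sizes of two successive strips. -/
structure StripSystem (P : Type*) where
  strips : P → Finset P
  size : P → ℕ
  size_le : ∀ {x y}, y ∈ strips x → size y ≤ size x
  self_mem : ∀ x, x ∈ strips x
  eq_of_size_eq : ∀ {x y}, y ∈ strips x → size y = size x → y = x
  flip : P → P → P → P
  flip_mem : ∀ {x y z}, y ∈ strips x → z ∈ strips y → flip x y z ∈ strips x
  mem_flip : ∀ {x y z}, y ∈ strips x → z ∈ strips y → z ∈ strips (flip x y z)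
  size_flip : ∀ {x y z}, y ∈ strips x → z ∈ strips y →
    size (flip x y z) + size y = size x + size z
  flip_flip : ∀ {x y z}, y ∈ strips x → z ∈ strips y → flip x (flip x y z) z = y

namespace StripSystem

variable {P : Type*} (S : StripSystem P)

/-- The number of ways to reduce `x` to size `0` by removing strips of the given sizes. -/
def count : P → List ℕ → ℤ
  | x, [] => if S.size x = 0 then 1 else 0
  | x, r :: l => ∑ y ∈ S.strips x with S.size y + r = S.size x, count y l

theorem count_nil (x : P) : S.count x [] = if S.size x = 0 then 1 else 0 := rfl

theorem count_cons (x : P) (r : ℕ) (l : List ℕ) :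
    S.count x (r :: l) = ∑ y ∈ S.strips x with S.size y + r = S.size x, S.count y l := rfl

theorem count_eq_zero {x : P} {l : List ℕ} (h : S.size x ≠ l.sum) : S.count x l = 0 := by
  induction l generalizing x with
  | nil => simpa [count_nil] using h
  | cons r l ih =>
    rw [count_cons]
    refine Finset.sum_eq_zero fun y hy => ih ?_
    rw [Finset.mem_filter] at hy
    rw [List.sum_cons] at h
    omega

theorem count_zero_cons (x : P) (l : List ℕ) : S.count x (0 :: l) = S.count x l := by
  rw [count_cons, Finset.sum_eq_single x]
  · intro y hy hne
    rw [Finset.mem_filter] at hy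
    exact absurd (S.eq_of_size_eq hy.1 hy.2) hne
  · intro h
    exact (h (by simp [S.self_mem x])).elim

theorem count_filter (x : P) (l : List ℕ) : S.count x (l.filter (· ≠ 0)) = S.count x l := by
  induction l generalizing x with
  | nil => rfl
  | cons r l ih =>
    by_cases hr : r = 0
    · subst hr
      rw [count_zero_cons, ← ih]
      rfl
    · rw [List.filter_cons_of_pos (by simpa using hr), count_cons, count_cons]
      exact Finset.sum_congr rfl fun y _ => ih y

/-- The abstract Bender–Knuth involution: `flip` changes the middle term of a chain `x, y, z` and
keeps `z`, so everything removed later is unaffected. -/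
theorem count_swap (x : P) (r s : ℕ) (l : List ℕ) :
    S.count x (r :: s :: l) = S.count x (s :: r :: l) := by
  simp only [count_cons]
  rw [Finset.sum_sigma', Finset.sum_sigma']
  refine Finset.sum_nbij' (fun p => ⟨S.flip x p.1 p.2, p.2⟩) (fun p => ⟨S.flip x p.1 p.2, p.2⟩)
    ?_ ?_ ?_ ?_ (fun _ _ => rfl)
  all_goals
    rintro ⟨y, z⟩ h
    simp only [Finset.mem_sigma, Finset.mem_filter] at h ⊢
    obtain ⟨⟨hy, h1⟩, hz, h2⟩ := h
  iterate 2
    have := S.size_flip hy hz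
    have := S.size_le hy
    have := S.size_le hz
    exact ⟨⟨S.flip_mem hy hz, by omega⟩, S.mem_flip hy hz, by omega⟩
  all_goals rw [S.flip_flip hy hz]

theorem count_perm {l l' : List ℕ} (h : l.Perm l') (x : P) : S.count x l = S.count x l' := by
  induction h generalizing x with
  | nil => rfl
  | cons r _ ih =>
    rw [count_cons, count_cons]
    exact Finset.sum_congr rfl fun y _ => ih y
  | swap r s l => exact S.count_swap x s r l
  | trans _ _ ih₁ ih₂ => exact (ih₁ x).trans (ih₂ x)

end StripSystem

/-! ### Alternating sums over compositions. -/

/-- The sum of `(-1) ^ (N - length l) * g l` over the compositions `l` of `N`. -/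
def alternating : ℕ → (List ℕ → ℤ) → ℤ
  | 0, g => g []
  | N + 1, g => ∑ r : Fin (N + 1), (-1) ^ (r : ℕ) *
      alternating (N - r) fun l => g (((r : ℕ) + 1) :: l)

theorem alternating_zero (g : List ℕ → ℤ) : alternating 0 g = g [] := by
  rw [alternating]

theorem alternating_succ (N : ℕ) (g : List ℕ → ℤ) :
    alternating (N + 1) g = ∑ r : Fin (N + 1), (-1) ^ (r : ℕ) *
      alternating (N - r) fun l => g (((r : ℕ) + 1) :: l) := by
  rw [alternating]

theorem alternating_sum {ι : Type*} (s : Finset ι) (c : ι → ℤ) (N : ℕ) (g : ι → List ℕ → ℤ) :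
    alternating N (fun l => ∑ i ∈ s, c i * g i l) = ∑ i ∈ s, c i * alternating N (g i) := by
  induction N using Nat.strong_induction_on generalizing g with
  | _ N ih =>
    cases N with
    | zero => simp only [alternating_zero]
    | succ N =>
      simp only [alternating_succ]
      simp_rw [fun r : Fin (N + 1) => ih (N - r) (by omega) (fun i l => g i (((r : ℕ) + 1) :: l)),
        Finset.mul_sum]
      rw [Finset.sum_comm]
      exact Finset.sum_congr rfl fun i _ => Finset.sum_congr rfl fun r _ => by ring

namespace StripSystem

variable {P : Type*} (S : StripSystem P)

/-- Split off the first strip of the composition. By induction a nonempty strip leaving `y`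
contributes `± v y`, and `hstep` says that these terms together with the term of the empty strip
cancel; the empty strip is excluded from compositions, so what remains is `v x`. -/
theorem alternating_count (v : P → ℤ) (k : ℕ) (hbase : ∀ x, S.size x = k → S.count x [k] = v x)
    (hsmall : ∀ x, S.size x < k → v x = 0)
    (hstep : ∀ x, k < S.size x → ∑ y ∈ S.strips x, (-1) ^ S.size y * v y = 0)
    (N : ℕ) (x : P) (hx : S.size x = N + k) :
    alternating N (fun l => S.count x (l ++ [k])) = v x := by
  classical
  induction N using Nat.strong_induction_on generalizing x with
  | _ N ih =>
    cases N with
    | zero => rw [alternating_zero]; exact hbase x (by omega)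
    | succ N =>
      rw [alternating_succ]
      have h1 : ∀ r : Fin (N + 1), (-1) ^ (r : ℕ) *
          alternating (N - r) (fun l => S.count x (((r : ℕ) + 1) :: l ++ [k])) =
          ∑ y ∈ S.strips x, if S.size y + (r + 1) = S.size x then (-1) ^ (r : ℕ) * v y else 0 := by
        intro r
        have h2 := alternating_sum (S.strips x |>.filter fun y => S.size y + (r + 1) = S.size x)
          (fun _ => 1) (N - r) (fun y l => S.count y (l ++ [k]))
        simp only [one_mul] at h2
        simp only [List.cons_append, count_cons]
        rw [h2, Finset.mul_sum, Finset.sum_filter]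
        refine Finset.sum_congr rfl fun y _ => ?_
        split_ifs with hy
        · rw [ih (N - r) (by omega) y (by omega)]
        · rfl
      rw [Finset.sum_congr rfl fun r _ => h1 r, Finset.sum_comm]
      -- A strip has size `r + 1` but sign `(-1)^r`, hence the global minus sign. For `y = x` no `r`
      -- qualifies, and `v x` compensates the term added on the right.
      have h3 : ∀ y ∈ S.strips x, (∑ r : Fin (N + 1),
          if S.size y + (r + 1) = S.size x then (-1) ^ (r : ℕ) * v y else 0) =
          -(-1) ^ S.size x * ((-1) ^ S.size y * v y) + if y = x then v x else 0 := by
        intro y hy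
        by_cases hyx : y = x
        · subst hyx
          rw [if_pos rfl, Finset.sum_eq_zero fun r _ => if_neg (by omega), ← mul_assoc,
            neg_mul, ← pow_add, Even.neg_one_pow ⟨_, rfl⟩]
          ring
        · have hle := S.size_le hy
          have hne : S.size y ≠ S.size x := fun h => hyx (S.eq_of_size_eq hy h)
          rw [if_neg hyx, add_zero]
          by_cases hk : S.size y < k
          · simp [hsmall y hk]
          · rw [Finset.sum_eq_single ⟨S.size x - S.size y - 1, by omega⟩]
            · rw [if_pos (by simp only; omega), ← mul_assoc]
              congr 1
              obtain ⟨t, ht⟩ : ∃ t, S.size x = S.size y + t + 1 :=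
                ⟨S.size x - S.size y - 1, by omega⟩
              have : S.size x - S.size y - 1 = t := by omega
              simp only [this]
              rw [ht, pow_succ, pow_add, mul_neg_one, neg_neg, mul_right_comm, ← pow_add,
                Even.neg_one_pow ⟨_, rfl⟩, one_mul]
            · intro r _ hr
              refine if_neg fun h => hr (Fin.ext ?_)
              simp only
              omega
            · simp
      rw [Finset.sum_congr rfl h3, Finset.sum_add_distrib, ← Finset.mul_sum,
        hstep x (by omega), mul_zero, zero_add, Finset.sum_ite_eq' , if_pos (S.self_mem x)]

end StripSystem

/-! ### Strip counts as monomial coefficients. -/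

/-- The exponent vector of a list of exponents, the last entry belonging to the variable `0`. -/
def exponent : List ℕ → ℕ →₀ ℕ
  | [] => 0
  | r :: l => exponent l + Finsupp.single l.length r

theorem exponent_apply_of_le {l : List ℕ} {i : ℕ} (h : l.length ≤ i) : exponent l i = 0 := by
  induction l with
  | nil => rfl
  | cons r l ih =>
    rw [List.length_cons] at h
    rw [exponent, Finsupp.add_apply, ih (by omega), Finsupp.single_eq_of_ne (by omega), add_zero]

theorem exists_exponent_eq (d : ℕ →₀ ℕ) : ∃ l, exponent l = d := by
  suffices h : ∀ N (d : ℕ →₀ ℕ), (∀ i, N ≤ i → d i = 0) → ∃ l, l.length = N ∧ exponent l = d by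
    obtain ⟨l, -, hl⟩ := h (d.support.sup id + 1) d fun i hi => by
      by_contra hd
      have := Finset.le_sup (f := id) (Finsupp.mem_support_iff.2 hd)
      simp only [id] at this
      omega
    exact ⟨l, hl⟩
  intro N
  induction N with
  | zero => exact fun d hd => ⟨[], rfl, by ext i; exact (hd i (by omega)).symm⟩
  | succ N ih =>
    intro d hd
    obtain ⟨l, hl, h⟩ := ih (d.erase N) fun i hi => by
      by_cases hiN : i = N
      · rw [hiN, Finsupp.erase_same]
      · rw [Finsupp.erase_ne hiN, hd i (by omega)]
    refine ⟨d N :: l, by rw [List.length_cons, hl], ?_⟩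
    rw [exponent, h, hl, Finsupp.erase_add_single]

/-- The objects of a strip system realised as finite sets of cells, in such a way that successive
removals of strips are recorded by fillings of the cells with natural numbers. -/
structure FillingModel {P : Type*} (S : StripSystem P) (X : Type*) where
  cells : P → Finset X
  valid : P → (X → ℕ) → Prop
  card_cells : ∀ x, (cells x).card = S.size x
  cells_injective : Function.Injective cells
  cells_subset : ∀ {x y}, y ∈ S.strips x → cells y ⊆ cells x
  apply_eq_zero : ∀ {x κ c}, valid x κ → c ∉ cells x → κ c = 0
  valid_zero : ∀ {x}, cells x = ∅ → valid x 0
  restrict : ∀ {x κ N}, valid x κ → (∀ c ∈ cells x, κ c ≤ N) → ∃ y ∈ S.strips x,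
    (∀ c, c ∈ cells y ↔ c ∈ cells x ∧ κ c < N) ∧ ∀ κ', (∀ c ∈ cells y, κ' c = κ c) →
      (∀ c ∉ cells y, κ' c = 0) → valid y κ'
  extend : ∀ {x y κ N}, y ∈ S.strips x → valid y κ → (∀ c ∈ cells y, κ c < N) →
    ∀ κ', (∀ c ∈ cells y, κ' c = κ c) → (∀ c ∈ cells x, c ∉ cells y → κ' c = N) →
      (∀ c ∉ cells x, κ' c = 0) → valid x κ'

namespace FillingModel

variable {P X : Type*} {S : StripSystem P} (M : FillingModel S X)

/-- The valid fillings of `x` of weight `d`. -/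
def fillings (x : P) (d : ℕ →₀ ℕ) : Set (X → ℕ) :=
  {κ | M.valid x κ ∧ ∑ c ∈ M.cells x, Finsupp.single (κ c) 1 = d}

theorem finite_fillings (x : P) (d : ℕ →₀ ℕ) : (M.fillings x d).Finite := by
  have hF : Set.InjOn (fun (κ : X → ℕ) (c : M.cells x) => κ c) (M.fillings x d) := by
    intro κ hκ κ' hκ' h
    ext c
    by_cases hc : c ∈ M.cells x
    · exact congrFun h ⟨c, hc⟩
    · rw [M.apply_eq_zero hκ.1 hc, M.apply_eq_zero hκ'.1 hc]
  refine Set.Finite.of_finite_image ((finite_colorWeight d).subset ?_) hF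
  rintro _ ⟨κ, hκ, rfl⟩
  rw [Set.mem_ofPred_eq, ← hκ.2]
  exact Finset.sum_coe_sort (M.cells x) (fun c => (Finsupp.single (κ c) 1 : ℕ →₀ ℕ))

theorem apply_lt {x : P} {d : ℕ →₀ ℕ} {κ : X → ℕ} (hκ : κ ∈ M.fillings x d) {N : ℕ}
    (hd : ∀ i, N ≤ i → d i = 0) {c : X} (hc : c ∈ M.cells x) : κ c < N := by
  by_contra h
  have h0 := hd (κ c) (by omega)
  rw [← hκ.2, Finsupp.finsetSum_apply, Finset.sum_eq_zero_iff] at h0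
  simpa using h0 c hc

/-- The cells carrying the largest possible value `N` form a strip, and deleting them leaves a
filling with values below `N`. This matches the recursion that defines `StripSystem.count`. -/
theorem ncard_fillings_add_single (x : P) {d : ℕ →₀ ℕ} {N : ℕ} (hd : ∀ i, N ≤ i → d i = 0)
    (r : ℕ) : ((M.fillings x (d + Finsupp.single N r)).ncard : ℤ) =
      ∑ y ∈ S.strips x with S.size y + r = S.size x, ((M.fillings y d).ncard : ℤ) := by
  classical
  have hlt : ∀ κ ∈ M.fillings x (d + Finsupp.single N r), ∀ c ∈ M.cells x, κ c ≤ N := by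
    intro κ hκ c hc
    refine Nat.lt_succ_iff.1 (M.apply_lt hκ (fun i hi => ?_) hc)
    rw [Finsupp.add_apply, hd i (by omega), Finsupp.single_eq_of_ne (by omega), add_zero]
  have : Nonempty P := ⟨x⟩
  choose! res hres_mem hres hres_valid using
    fun κ (h : M.valid x κ ∧ ∀ c ∈ M.cells x, κ c ≤ N) => M.restrict h.1 h.2
  simp_rw [Set.ncard_eq_toFinset_card _ (M.finite_fillings _ _)]
  rw [← Nat.cast_sum, ← Finset.card_sigma]
  congr 1
  have hsplit : ∀ (y : P), y ∈ S.strips x → ∀ κ : X → ℕ, (∀ c ∈ M.cells x, c ∉ M.cells y → κ c = N) →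
      ∑ c ∈ M.cells x, (Finsupp.single (κ c) 1 : ℕ →₀ ℕ) =
        ∑ c ∈ M.cells y, Finsupp.single (κ c) 1 + Finsupp.single N (S.size x - S.size y) := by
    intro y hy κ hκ
    rw [← Finset.sum_sdiff (M.cells_subset hy), add_comm]
    congr 1
    rw [Finset.sum_congr rfl (g := fun _ => Finsupp.single N 1)
      fun c hc => by rw [hκ c (Finset.mem_sdiff.1 hc).1 (Finset.mem_sdiff.1 hc).2],
      Finset.sum_const, Finset.card_sdiff_of_subset (M.cells_subset hy), M.card_cells, M.card_cells,
      Finsupp.smul_single, smul_eq_mul, mul_one]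
  refine Finset.card_nbij'
    (fun κ => ⟨res κ, fun c => if c ∈ M.cells (res κ) then κ c else 0⟩)
    (fun p c => if c ∈ M.cells p.1 then p.2 c else if c ∈ M.cells x then N else 0) ?_ ?_ ?_ ?_
  · intro κ hκ
    simp only [Finset.mem_coe, Set.Finite.mem_toFinset] at hκ
    have h := And.intro hκ.1 (hlt κ hκ)
    have hs := hsplit (res κ) (hres_mem κ h) κ fun c hc hc' => by
      rw [hres κ h] at hc'
      have := hlt κ hκ c hc
      by_contra hne
      exact hc' ⟨hc, by omega⟩
    rw [hκ.2] at hs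
    have hN : ∀ c ∈ M.cells (res κ), κ c < N := fun c hc => ((hres κ h c).1 hc).2
    have h0 : (∑ c ∈ M.cells (res κ), (Finsupp.single (κ c) 1 : ℕ →₀ ℕ)) N = 0 := by
      rw [Finsupp.finsetSum_apply]
      exact Finset.sum_eq_zero fun c hc =>
        Finsupp.single_eq_of_ne (hN c hc).ne'
    -- Comparing multiplicities of `N`: neither `d` nor the restricted filling involves it.
    have hr : r = S.size x - S.size (res κ) := by
      have := DFunLike.congr_fun hs N
      rw [Finsupp.add_apply, Finsupp.add_apply, h0, hd N le_rfl] at this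
      simpa using this
    have hle := S.size_le (hres_mem κ h)
    simp only [Finset.mem_coe, Finset.mem_sigma, Finset.mem_filter, Set.Finite.mem_toFinset]
    refine ⟨⟨hres_mem κ h, by omega⟩, hres_valid κ h _ (fun c hc => if_pos hc)
      fun c hc => if_neg hc, ?_⟩
    rw [← hr] at hs
    rw [add_right_cancel hs]
    exact Finset.sum_congr rfl fun c hc => by simp only [if_pos hc]
  · rintro ⟨y, κ⟩ hp
    simp only [Finset.mem_coe, Finset.mem_sigma, Finset.mem_filter, Set.Finite.mem_toFinset] at hp
    obtain ⟨⟨hy, hr⟩, hκ⟩ := hp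
    have hN : ∀ c ∈ M.cells y, κ c < N := fun c hc => M.apply_lt hκ hd hc
    simp only [Finset.mem_coe, Set.Finite.mem_toFinset]
    refine ⟨M.extend hy hκ.1 hN _ (fun c hc => if_pos hc)
      (fun c hc hc' => by rw [if_neg hc', if_pos hc])
      (fun c hc => by rw [if_neg fun h => hc (M.cells_subset hy h), if_neg hc]), ?_⟩
    rw [hsplit y hy _ fun c hc hc' => by rw [if_neg hc', if_pos hc]]
    have : S.size x - S.size y = r := by omega
    rw [this, ← hκ.2]
    congr 1
    exact Finset.sum_congr rfl fun c hc => by rw [if_pos hc]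
  · intro κ hκ
    simp only [Finset.mem_coe, Set.Finite.mem_toFinset] at hκ
    have h := And.intro hκ.1 (hlt κ hκ)
    ext c
    by_cases hc : c ∈ M.cells (res κ)
    · simp only [if_pos hc]
    · simp only [if_neg hc]
      by_cases hcx : c ∈ M.cells x
      · rw [if_pos hcx]
        rw [hres κ h] at hc
        have := hlt κ hκ c hcx
        by_contra hne
        exact hc ⟨hcx, by omega⟩
      · rw [if_neg hcx, M.apply_eq_zero hκ.1 hcx]
  · rintro ⟨y, κ⟩ hp
    simp only [Finset.mem_coe, Finset.mem_sigma, Finset.mem_filter, Set.Finite.mem_toFinset] at hp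
    obtain ⟨⟨hy, hr⟩, hκ⟩ := hp
    have hN : ∀ c ∈ M.cells y, κ c < N := fun c hc => M.apply_lt hκ hd hc
    set κ' : X → ℕ := fun c => if c ∈ M.cells y then κ c else if c ∈ M.cells x then N else 0
      with hκ'
    have hv : M.valid x κ' := M.extend hy hκ.1 hN _ (fun c hc => if_pos hc)
      (fun c hc hc' => by rw [hκ']; simp only [if_neg hc', if_pos hc])
      (fun c hc => by rw [hκ']; simp only [if_neg fun h => hc (M.cells_subset hy h), if_neg hc])
    have hle : ∀ c ∈ M.cells x, κ' c ≤ N := by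
      intro c hc
      simp only [hκ', if_pos hc]
      split_ifs with h
      · exact (hN c h).le
      · exact le_rfl
    have hy' : res κ' = y := by
      apply M.cells_injective
      ext c
      rw [hres κ' ⟨hv, hle⟩]
      constructor
      · rintro ⟨hc, h⟩
        by_contra hcy
        simp only [hκ', if_neg hcy, if_pos hc, lt_irrefl] at h
      · intro hc
        refine ⟨M.cells_subset hy hc, ?_⟩
        simp only [hκ', if_pos hc]
        exact hN c hc
    change (⟨res κ', fun c => if c ∈ M.cells (res κ') then κ' c else 0⟩ : (_ : P) × (X → ℕ)) = ⟨y, κ⟩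
    simp only [hy', Sigma.mk.injEq, heq_eq_eq, true_and]
    ext c
    by_cases hc : c ∈ M.cells y
    · simp only [hκ', if_pos hc]
    · simp only [if_neg hc, M.apply_eq_zero hκ.1 hc]

theorem ncard_fillings_exponent (x : P) (l : List ℕ) :
    ((M.fillings x (exponent l)).ncard : ℤ) = S.count x l := by
  induction l generalizing x with
  | nil =>
    rw [S.count_nil, exponent]
    split_ifs with h
    · have hc : M.cells x = ∅ := by rw [← Finset.card_eq_zero, M.card_cells, h]
      have : M.fillings x 0 = {0} := by
        ext κ
        simp only [fillings, hc, Finset.sum_empty, and_true, Set.mem_ofPred_eq,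
          Set.mem_singleton_iff]
        constructor
        · intro hv
          ext c
          exact M.apply_eq_zero hv (by simp [hc])
        · rintro rfl
          exact M.valid_zero hc
      rw [this, Set.ncard_singleton, Nat.cast_one]
    · have : M.fillings x 0 = ∅ := by
        rw [Set.eq_empty_iff_forall_notMem]
        intro κ hκ
        rw [← M.card_cells, ← ne_eq, Finset.card_ne_zero] at h
        obtain ⟨c, hc⟩ := h
        exact absurd (M.apply_lt hκ (N := 0) (fun _ _ => rfl) hc) (by omega)
      rw [this, Set.ncard_empty, Nat.cast_zero]
  | cons r l ih =>
    rw [exponent, M.ncard_fillings_add_single x fun i hi => exponent_apply_of_le hi, S.count_cons]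
    exact Finset.sum_congr rfl fun y _ => ih y

end FillingModel

/-! ### Horizontal strips and Schur functions. -/

theorem young_le_iff {μ ν : YoungDiagram} : μ ≤ ν ↔ ∀ i, μ.rowLen i ≤ ν.rowLen i := by
  constructor
  · intro h i
    by_contra hlt
    have : (i, ν.rowLen i) ∈ μ := YoungDiagram.mem_iff_lt_rowLen.2 (by omega)
    exact absurd (YoungDiagram.mem_iff_lt_rowLen.1 (h this)) (lt_irrefl _)
  · rintro h ⟨i, j⟩ hc
    exact YoungDiagram.mem_iff_lt_rowLen.2 ((YoungDiagram.mem_iff_lt_rowLen.1 hc).trans_le (h i))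

theorem young_ext {μ ν : YoungDiagram} (h : ∀ i, μ.rowLen i = ν.rowLen i) : μ = ν :=
  le_antisymm (young_le_iff.2 fun i => (h i).le) (young_le_iff.2 fun i => (h i).ge)

theorem rowLen_eq_zero_iff {μ : YoungDiagram} {i : ℕ} : μ.rowLen i = 0 ↔ μ.colLen 0 ≤ i := by
  rw [← not_lt, ← YoungDiagram.mem_iff_lt_colLen, YoungDiagram.mem_iff_lt_rowLen]
  omega

theorem card_eq_sum_rowLen (μ : YoungDiagram) {M : ℕ} (hM : μ.colLen 0 ≤ M) :
    μ.card = ∑ i ∈ Finset.range M, μ.rowLen i := by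
  classical
  have := Finset.card_eq_sum_card_fiberwise (f := Prod.fst) (s := μ.cells) (t := Finset.range M) <| by
    rintro ⟨i, j⟩ h
    have h0 : (i, 0) ∈ μ := μ.up_left_mem le_rfl (Nat.zero_le j) h
    rw [YoungDiagram.mem_iff_lt_colLen] at h0
    simpa using h0.trans_le hM
  refine this.trans (Finset.sum_congr rfl fun i _ => ?_)
  rw [YoungDiagram.rowLen_eq_card]
  rfl

theorem young_eq_of_le_of_card {μ ν : YoungDiagram} (h : μ ≤ ν) (hc : μ.card = ν.card) : μ = ν :=
  YoungDiagram.ext (Finset.eq_of_subset_of_card_le (YoungDiagram.cells_subset_iff.2 h) hc.ge)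

/-- The largest subdiagram of `μ` with row lengths bounded by `f`. -/
def truncate (μ : YoungDiagram) (f : ℕ → ℕ) : YoungDiagram where
  cells := μ.cells.filter fun c => ∀ i ≤ c.1, c.2 < f i
  isLowerSet := by
    rintro ⟨i, j⟩ ⟨i', j'⟩ ⟨hi, hj⟩ h
    simp only [Finset.coe_filter, Set.mem_ofPred_eq] at h ⊢
    exact ⟨μ.up_left_mem hi hj h.1, fun a ha => lt_of_le_of_lt hj (h.2 a (ha.trans hi))⟩

theorem rowLen_truncate {μ : YoungDiagram} {f : ℕ → ℕ} (hf : Antitone f)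
    (hle : ∀ i, f i ≤ μ.rowLen i) (i : ℕ) : (truncate μ f).rowLen i = f i := by
  have key : ∀ j, j < (truncate μ f).rowLen i ↔ j < f i := by
    intro j
    rw [← YoungDiagram.mem_iff_lt_rowLen, ← YoungDiagram.mem_cells]
    simp only [truncate, Finset.mem_filter, YoungDiagram.mem_cells, YoungDiagram.mem_iff_lt_rowLen]
    constructor
    · exact fun h => h.2 i le_rfl
    · exact fun h => ⟨h.trans_le (hle i), fun a ha => h.trans_le (hf ha)⟩
  refine le_antisymm ?_ ?_
  · by_contra h
    exact absurd ((key (f i)).1 (by omega)) (lt_irrefl _)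
  · by_contra h
    exact absurd ((key _).2 (not_le.1 h)) (lt_irrefl _)

theorem finite_young_le (μ : YoungDiagram) : {ν : YoungDiagram | ν ≤ μ}.Finite :=
  (μ.cells.powerset.finite_toSet.preimage
    (Function.Injective.injOn fun _ _ h => YoungDiagram.ext h)).subset fun _ h =>
      Finset.mem_coe.2 (Finset.mem_powerset.2 (YoungDiagram.cells_subset_iff.2 h))

/-- The diagrams obtained from `μ` by removing a horizontal strip. -/
def removeStrip (μ : YoungDiagram) : Finset YoungDiagram :=
  ((finite_young_le μ).subset (t := {ν | ν ≤ μ ∧ ∀ i, μ.rowLen (i + 1) ≤ ν.rowLen i})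
    fun _ h => h.1).toFinset

theorem mem_removeStrip {μ ν : YoungDiagram} :
    ν ∈ removeStrip μ ↔ ∀ i, ν.rowLen i ≤ μ.rowLen i ∧ μ.rowLen (i + 1) ≤ ν.rowLen i := by
  rw [removeStrip, Set.Finite.mem_toFinset, Set.mem_ofPred_eq, young_le_iff, forall_and]

theorem le_of_mem_removeStrip {μ ν : YoungDiagram} (h : ν ∈ removeStrip μ) : ν ≤ μ :=
  young_le_iff.2 fun i => (mem_removeStrip.1 h i).1

theorem antitone_of_interlace {μ : YoungDiagram} {f : ℕ → ℕ}
    (hf : ∀ i, f i ≤ μ.rowLen i ∧ μ.rowLen (i + 1) ≤ f i) : Antitone f :=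
  antitone_nat_of_succ_le fun i => (hf (i + 1)).1.trans (hf i).2

theorem rowLen_truncate_of_interlace {μ : YoungDiagram} {f : ℕ → ℕ}
    (hf : ∀ i, f i ≤ μ.rowLen i ∧ μ.rowLen (i + 1) ≤ f i) (i : ℕ) :
    (truncate μ f).rowLen i = f i :=
  rowLen_truncate (antitone_of_interlace hf) (fun i => (hf i).1) i

theorem truncate_mem_removeStrip {μ : YoungDiagram} {f : ℕ → ℕ}
    (hf : ∀ i, f i ≤ μ.rowLen i ∧ μ.rowLen (i + 1) ≤ f i) : truncate μ f ∈ removeStrip μ :=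
  mem_removeStrip.2 fun i => by rw [rowLen_truncate_of_interlace hf]; exact hf i

/-- The least possible length of row `i` of a diagram between `κ` and `μ`. -/
def lowerBound (μ κ : YoungDiagram) (i : ℕ) : ℕ := max (μ.rowLen (i + 1)) (κ.rowLen i)

/-- The greatest possible length of row `i` of a diagram between `κ` and `μ`. -/
def upperBound (μ κ : YoungDiagram) : ℕ → ℕ
  | 0 => μ.rowLen 0
  | i + 1 => min (μ.rowLen (i + 1)) (κ.rowLen i)

/-- Reflection of the row lengths of `ν` between their bounds. -/
def reflect (μ ν κ : YoungDiagram) : YoungDiagram :=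
  truncate μ fun i => lowerBound μ κ i + upperBound μ κ i - ν.rowLen i

/-- With both ends fixed, the interlacing conditions decouple: each row of the middle diagram ranges
over its own interval, independently of the others. Reflecting every row in its interval is
therefore legitimate. -/
theorem between_iff {μ ν κ : YoungDiagram} : (ν ∈ removeStrip μ ∧ κ ∈ removeStrip ν) ↔
    ∀ i, lowerBound μ κ i ≤ ν.rowLen i ∧ ν.rowLen i ≤ upperBound μ κ i := by
  rw [mem_removeStrip, mem_removeStrip]
  simp only [lowerBound]
  constructor
  · rintro ⟨h1, h2⟩ i
    refine ⟨max_le (h1 i).2 (h2 i).1, ?_⟩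
    cases i with
    | zero => exact (h1 0).1
    | succ i => exact le_min (h1 _).1 (h2 i).2
  · intro h
    have h' : ∀ i, ν.rowLen (i + 1) ≤ min (μ.rowLen (i + 1)) (κ.rowLen i) := fun i => (h (i + 1)).2
    have h0 : ν.rowLen 0 ≤ μ.rowLen 0 := (h 0).2
    refine ⟨fun i => ⟨?_, (le_max_left _ _).trans (h i).1⟩,
      fun i => ⟨(le_max_right _ _).trans (h i).1, (h' i).trans (min_le_right _ _)⟩⟩
    cases i with
    | zero => exact h0
    | succ i => exact (h' i).trans (min_le_left _ _)

theorem rowLen_reflect {μ ν κ : YoungDiagram} (hν : ν ∈ removeStrip μ) (hκ : κ ∈ removeStrip ν)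
    (i : ℕ) : (reflect μ ν κ).rowLen i = lowerBound μ κ i + upperBound μ κ i - ν.rowLen i := by
  have h := between_iff.1 ⟨hν, hκ⟩
  refine rowLen_truncate_of_interlace (fun i => ?_) i
  have h1 : upperBound μ κ i ≤ μ.rowLen i := by
    cases i with
    | zero => exact le_rfl
    | succ i => exact min_le_left _ _
  have h2 : μ.rowLen (i + 1) ≤ lowerBound μ κ i := le_max_left _ _
  have := h i
  omega

theorem reflect_between {μ ν κ : YoungDiagram} (hν : ν ∈ removeStrip μ)
    (hκ : κ ∈ removeStrip ν) : reflect μ ν κ ∈ removeStrip μ ∧ κ ∈ removeStrip (reflect μ ν κ) := by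
  rw [between_iff]
  intro i
  rw [rowLen_reflect hν hκ]
  have := between_iff.1 ⟨hν, hκ⟩ i
  omega

/-- The lower bound of row `i` and the upper bound of row `i + 1` are the max and the min of the
same two lengths, so the sums match up to boundary terms. -/
theorem sum_bounds (μ κ : YoungDiagram) (M : ℕ) :
    ∑ i ∈ Finset.range M, (lowerBound μ κ i + upperBound μ κ i) + upperBound μ κ M =
      ∑ i ∈ Finset.range M, (μ.rowLen i + κ.rowLen i) + μ.rowLen M := by
  induction M with
  | zero => rfl
  | succ M ih =>
    rw [Finset.sum_range_succ, Finset.sum_range_succ]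
    have := max_add_min (μ.rowLen (M + 1)) (κ.rowLen M)
    simp only [upperBound, lowerBound] at ih this ⊢
    omega

theorem card_reflect {μ ν κ : YoungDiagram} (hν : ν ∈ removeStrip μ) (hκ : κ ∈ removeStrip ν) :
    (reflect μ ν κ).card + ν.card = μ.card + κ.card := by
  have hle : ∀ {ρ : YoungDiagram}, ρ ≤ μ → ρ.colLen 0 ≤ μ.colLen 0 := by
    intro ρ h
    rw [← rowLen_eq_zero_iff]
    exact Nat.eq_zero_of_le_zero ((young_le_iff.1 h _).trans (rowLen_eq_zero_iff.2 le_rfl).le)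
  have hν' := le_of_mem_removeStrip hν
  rw [card_eq_sum_rowLen μ le_rfl, card_eq_sum_rowLen ν (hle hν'),
    card_eq_sum_rowLen κ (hle ((le_of_mem_removeStrip hκ).trans hν')),
    card_eq_sum_rowLen (reflect μ ν κ) (hle (le_of_mem_removeStrip (reflect_between hν hκ).1)),
    ← Finset.sum_add_distrib, ← Finset.sum_add_distrib]
  have h := sum_bounds μ κ (μ.colLen 0)
  have h0 : μ.rowLen (μ.colLen 0) = 0 := rowLen_eq_zero_iff.2 le_rfl
  have h1 : upperBound μ κ (μ.colLen 0) = 0 := by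
    cases hm : μ.colLen 0 with
    | zero => rw [hm] at h0; exact h0
    | succ m => rw [hm] at h0; simp [upperBound, h0]
  rw [h0, h1] at h
  rw [add_zero, add_zero] at h
  rw [← h]
  refine Finset.sum_congr rfl fun i _ => ?_
  rw [rowLen_reflect hν hκ]
  have := between_iff.1 ⟨hν, hκ⟩ i
  omega

theorem reflect_reflect {μ ν κ : YoungDiagram} (hν : ν ∈ removeStrip μ)
    (hκ : κ ∈ removeStrip ν) : reflect μ (reflect μ ν κ) κ = ν := by
  refine young_ext fun i => ?_
  have h' := reflect_between hν hκ
  rw [rowLen_reflect h'.1 h'.2, rowLen_reflect hν hκ]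
  have := between_iff.1 ⟨hν, hκ⟩ i
  omega

/-- Removal of horizontal strips from Young diagrams. -/
def youngSystem : StripSystem YoungDiagram where
  strips := removeStrip
  size := YoungDiagram.card
  size_le h := Finset.card_le_card (YoungDiagram.cells_subset_iff.2 (le_of_mem_removeStrip h))
  self_mem μ := mem_removeStrip.2 fun i => ⟨le_rfl, μ.rowLen_anti _ _ (Nat.le_succ i)⟩
  eq_of_size_eq h hc := young_eq_of_le_of_card (le_of_mem_removeStrip h) hc
  flip := reflect
  flip_mem hν hκ := (reflect_between hν hκ).1
  mem_flip hν hκ := (reflect_between hν hκ).2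
  size_flip hν hκ := card_reflect hν hκ
  flip_flip hν hκ := reflect_reflect hν hκ

/-- Semistandard fillings of Young diagrams. -/
def youngModel : FillingModel youngSystem (ℕ × ℕ) where
  cells := YoungDiagram.cells
  valid μ κ := (∀ i j₁ j₂, j₁ < j₂ → (i, j₂) ∈ μ → κ (i, j₁) ≤ κ (i, j₂)) ∧
    (∀ i₁ i₂ j, i₁ < i₂ → (i₂, j) ∈ μ → κ (i₁, j) < κ (i₂, j)) ∧ ∀ c, c ∉ μ → κ c = 0
  card_cells _ := rfl
  cells_injective _ _ h := YoungDiagram.ext h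
  cells_subset h := YoungDiagram.cells_subset_iff.2 (le_of_mem_removeStrip h)
  apply_eq_zero h hc := h.2.2 _ hc
  valid_zero {μ} h := by
    have h' : ∀ c, c ∉ μ := fun c hc => by
      rw [← YoungDiagram.mem_cells, h] at hc
      simp at hc
    exact ⟨fun _ _ _ _ hc => absurd hc (h' _), fun _ _ _ _ hc => absurd hc (h' _), fun _ _ => rfl⟩
  restrict {μ κ N} := by
    rintro ⟨hrow, hcol, h0⟩ hN
    have hrow' : ∀ i j₁ j₂, j₁ ≤ j₂ → (i, j₂) ∈ μ → κ (i, j₁) ≤ κ (i, j₂) := by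
      intro i j₁ j₂ h hc
      rcases h.eq_or_lt with rfl | h
      exacts [le_rfl, hrow _ _ _ h hc]
    have hcol' : ∀ i₁ i₂ j, i₁ ≤ i₂ → (i₂, j) ∈ μ → κ (i₁, j) ≤ κ (i₂, j) := by
      intro i₁ i₂ j h hc
      rcases h.eq_or_lt with rfl | h
      exacts [le_rfl, (hcol _ _ _ h hc).le]
    let ν : YoungDiagram :=
      { cells := μ.cells.filter fun c => κ c < N
        isLowerSet := by
          rintro ⟨i, j⟩ ⟨i', j'⟩ ⟨hi, hj⟩ h
          simp only [Finset.coe_filter, Set.mem_ofPred_eq, YoungDiagram.mem_cells] at h ⊢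
          exact ⟨μ.up_left_mem hi hj h.1, ((hrow' _ _ _ hj (μ.up_left_mem hi le_rfl h.1)).trans
            (hcol' _ _ _ hi h.1)).trans_lt h.2⟩ }
    have hν : ∀ c, c ∈ ν ↔ c ∈ μ ∧ κ c < N := by
      intro c
      rw [← YoungDiagram.mem_cells]
      simp only [ν, Finset.mem_filter, YoungDiagram.mem_cells]
    refine ⟨ν, ?_, hν, ?_⟩
    · refine mem_removeStrip.2 fun i => ⟨?_, ?_⟩
      · exact young_le_iff.1 (fun c hc => ((hν c).1 hc).1) i
      -- Otherwise the cell of `μ` in row `i + 1` and column `ν.rowLen i` has value at most `N`; by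
      -- column strictness the cell above it has value below `N`, so it lies in `ν`, beyond the end
      -- of row `i`.
      · by_contra h
        have h1 : (i + 1, ν.rowLen i) ∈ μ := YoungDiagram.mem_iff_lt_rowLen.2 (not_le.1 h)
        have h2 : (i, ν.rowLen i) ∈ ν := (hν _).2 ⟨μ.up_left_mem (Nat.le_succ i) le_rfl h1,
          (hcol _ _ _ (Nat.lt_succ_self i) h1).trans_le (hN _ h1)⟩
        exact absurd (YoungDiagram.mem_iff_lt_rowLen.1 h2) (lt_irrefl _)
    · intro κ' h1 h2
      refine ⟨fun i j₁ j₂ h hc => ?_, fun i₁ i₂ j h hc => ?_, h2⟩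
      · rw [h1 _ hc, h1 _ (ν.up_left_mem le_rfl h.le hc)]
        exact hrow _ _ _ h ((hν _).1 hc).1
      · rw [h1 _ hc, h1 _ (ν.up_left_mem h.le le_rfl hc)]
        exact hcol _ _ _ h ((hν _).1 hc).1
  extend {μ ν κ N} := by
    rintro hν ⟨hrow, hcol, -⟩ hN κ' h1 h2 h3
    have hle : ∀ c ∈ μ, κ' c ≤ N := by
      intro c hc
      by_cases hcν : c ∈ ν
      · rw [h1 c hcν]; exact (hN c hcν).le
      · rw [h2 c hc hcν]
    refine ⟨fun i j₁ j₂ h hc => ?_, fun i₁ i₂ j h hc => ?_, h3⟩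
    · by_cases hcν : (i, j₂) ∈ ν
      · rw [h1 _ hcν, h1 _ (ν.up_left_mem le_rfl h.le hcν)]
        exact hrow _ _ _ h hcν
      · rw [h2 _ hc hcν]
        exact hle _ (μ.up_left_mem le_rfl h.le hc)
    · by_cases hcν : (i₂, j) ∈ ν
      · rw [h1 _ hcν, h1 _ (ν.up_left_mem h.le le_rfl hcν)]
        exact hcol _ _ _ h hcν
      -- A horizontal strip has at most one cell in each column, so the cells above a strip cell
      -- survive.
      · have h4 : (i₁, j) ∈ ν := by
          have h5 : (i₁ + 1, j) ∈ μ := μ.up_left_mem h le_rfl hc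
          rw [YoungDiagram.mem_iff_lt_rowLen] at h5 ⊢
          exact h5.trans_le (mem_removeStrip.1 hν i₁).2
        rw [h2 _ hc hcν, h1 _ h4]
        exact hN _ h4

theorem schur_exponent (μ : YoungDiagram) (l : List ℕ) :
    schur μ (exponent l) = youngSystem.count μ l := by
  rw [← youngModel.ncard_fillings_exponent μ l]
  change (Nat.card _ : ℤ) = (Nat.card _ : ℤ)
  congr 1
  refine Nat.card_congr
    { toFun := fun T => ⟨fun c => T.1 c.1 c.2, ⟨fun i j₁ j₂ h hc => T.1.row_weak h hc,
        fun i₁ i₂ j h hc => T.1.col_strict h hc, fun c hc => T.1.zeros hc⟩, T.2⟩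
      invFun := fun κ => ⟨⟨fun i j => κ.1 (i, j), fun h hc => κ.2.1.1 _ _ _ h hc,
        fun h hc => κ.2.1.2.1 _ _ _ h hc, fun hc => κ.2.1.2.2 _ hc⟩, κ.2.2⟩
      left_inv := fun T => rfl
      right_inv := fun κ => rfl }

/-! ### The alternating functional on Schur functions. -/

/-- The value on `s_μ` of the functional `alternating`, the last block having size `k`. -/
def hookIndicator (k : ℕ) (μ : YoungDiagram) : ℤ :=
  open scoped Classical in
  if k ≤ μ.rowLen 0 ∧ μ.rowLen 0 ≤ k + 1 ∧ ∀ i, 1 ≤ i → μ.rowLen i ≤ 1 then 1 else 0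

theorem rowLen_zero_le_card (μ : YoungDiagram) : μ.rowLen 0 ≤ μ.card := by
  rw [YoungDiagram.rowLen_eq_card]
  exact Finset.card_le_card (Finset.filter_subset _ _)

theorem rowLen_succ_eq_zero {μ : YoungDiagram} (h : μ.card ≤ μ.rowLen 0) (i : ℕ) :
    μ.rowLen (i + 1) = 0 := by
  have h1 := card_eq_sum_rowLen μ (M := μ.colLen 0 + i + 2) (by omega)
  rw [Finset.sum_range_succ'] at h1
  have h2 := Finset.single_le_sum (f := fun i => μ.rowLen (i + 1)) (fun _ _ => Nat.zero_le _)
    (Finset.mem_range.2 (by omega : i < μ.colLen 0 + i + 1))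
  omega

theorem count_singleton_young {μ : YoungDiagram} {k : ℕ} (h : μ.card = k) :
    youngSystem.count μ [k] = hookIndicator k μ := by
  have hbot : ∀ i, (⊥ : YoungDiagram).rowLen i = 0 := fun i => by
    by_contra h
    exact YoungDiagram.notMem_bot _ (YoungDiagram.mem_iff_lt_rowLen.2 (Nat.pos_of_ne_zero h))
  have hcard : (⊥ : YoungDiagram).card = 0 := rfl
  have huniq : ∀ ν : YoungDiagram, ν.card = 0 → ν = ⊥ := fun ν hν =>
    YoungDiagram.ext (by rw [YoungDiagram.cells_bot]; exact Finset.card_eq_zero.1 hν)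
  have hle := rowLen_zero_le_card μ
  rw [StripSystem.count_cons, hookIndicator]
  split_ifs with hv
  · rw [Finset.sum_eq_single ⊥]
    · rw [StripSystem.count_nil, if_pos]
      exact hcard
    · intro ν hν hne
      exact absurd (huniq ν (by
        have := (Finset.mem_filter.1 hν).2
        simp only [youngSystem] at this
        omega)) hne
    · intro hn
      refine absurd (Finset.mem_filter.2 ⟨mem_removeStrip.2 fun i => ?_, ?_⟩) hn
      · rw [hbot, rowLen_succ_eq_zero (by omega)]
        exact ⟨Nat.zero_le _, le_rfl⟩
      · simp only [youngSystem, hcard]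
        omega
  · refine Finset.sum_eq_zero fun ν hν => absurd ?_ hv
    obtain ⟨hν, hc⟩ := Finset.mem_filter.1 hν
    simp only [youngSystem] at hc hν
    rw [huniq ν (by omega), mem_removeStrip] at hν
    have h0 : ∀ i, μ.rowLen (i + 1) = 0 := fun i => by
      have := (hν i).2
      rw [hbot] at this
      omega
    have h1 := card_eq_sum_rowLen μ (M := μ.colLen 0 + 1) (by omega)
    rw [Finset.sum_range_succ', Finset.sum_eq_zero fun i _ => h0 i] at h1
    refine ⟨by omega, by omega, fun i hi => ?_⟩
    obtain ⟨i, rfl⟩ := Nat.exists_eq_add_of_le' hi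
    rw [h0]
    exact zero_le_one

/-- A sign-reversing involution: add or delete one cell in the last nonempty row of `μ`, the row of
`ν` toggling between the two lengths that the indicator allows there. -/
theorem sum_hookIndicator {μ : YoungDiagram} {k : ℕ} (h : k < μ.card) :
    ∑ ν ∈ removeStrip μ, (-1) ^ ν.card * hookIndicator k ν = 0 := by
  classical
  -- `m` indexes the last nonempty row of `μ`, and `a`, `a + 1` are the lengths allowed in it: `k`,
  -- `k + 1` if it is the first row, and `0`, `1` otherwise.
  set m := μ.colLen 0 - 1 with hm
  set a := if m = 0 then k else 0 with ha
  have hpos : 0 < μ.colLen 0 := by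
    by_contra h0
    have := card_eq_sum_rowLen μ (M := 0) (by omega)
    rw [Finset.sum_range_zero] at this
    omega
  have hm1 : μ.rowLen (m + 1) = 0 := rowLen_eq_zero_iff.2 (by omega)
  -- Both lengths fit into `μ`; when `μ` is a single row this is the hypothesis `k < μ.card`.
  have hm2 : a + 1 ≤ μ.rowLen m := by
    rw [ha]
    split_ifs with h0
    · have := card_eq_sum_rowLen μ (M := 1) (by omega)
      rw [Finset.sum_range_one] at this
      rw [h0]
      omega
    · have : μ.rowLen m ≠ 0 := by rw [ne_eq, rowLen_eq_zero_iff]; omega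
      omega
  simp only [hookIndicator, mul_ite, mul_one, mul_zero]
  rw [← Finset.sum_filter]
  -- The map `t ↦ 2a + 1 - t` exchanges `a` and `a + 1`. Interlacing is preserved because row `m +
  -- 1` of `μ` is empty.
  let f : YoungDiagram → ℕ → ℕ := fun ν => Function.update ν.rowLen m (2 * a + 1 - ν.rowLen m)
  have hf : ∀ ν ∈ (removeStrip μ).filter (fun ν => k ≤ ν.rowLen 0 ∧ ν.rowLen 0 ≤ k + 1 ∧
      ∀ i, 1 ≤ i → ν.rowLen i ≤ 1), a ≤ ν.rowLen m ∧ ν.rowLen m ≤ a + 1 ∧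
        (∀ i, f ν i ≤ μ.rowLen i ∧ μ.rowLen (i + 1) ≤ f ν i) ∧
        (∀ i, (truncate μ (f ν)).rowLen i = f ν i) ∧
        (truncate μ (f ν)).card + ν.rowLen m = ν.card + (2 * a + 1 - ν.rowLen m) := by
    intro ν hν
    obtain ⟨hν, hk, hk', h1⟩ := Finset.mem_filter.1 hν
    have hlo : a ≤ ν.rowLen m ∧ ν.rowLen m ≤ a + 1 := by
      rw [ha]
      split_ifs with h0
      · rw [h0]; exact ⟨hk, hk'⟩
      · exact ⟨Nat.zero_le _, h1 m (by omega)⟩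
    have hi : ∀ i, f ν i ≤ μ.rowLen i ∧ μ.rowLen (i + 1) ≤ f ν i := by
      intro i
      by_cases hi : i = m
      · rw [hi]
        simp only [f, Function.update_self]
        omega
      · simp only [f, Function.update_of_ne hi]
        exact mem_removeStrip.1 hν i
    refine ⟨hlo.1, hlo.2, hi, rowLen_truncate_of_interlace hi, ?_⟩
    have hcol : ∀ ρ ≤ μ, ρ.colLen 0 ≤ m + 1 := fun ρ hρ => by
      rw [← rowLen_eq_zero_iff]
      exact Nat.eq_zero_of_le_zero ((young_le_iff.1 hρ _).trans hm1.le)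
    rw [card_eq_sum_rowLen ν (hcol ν (le_of_mem_removeStrip hν)),
      card_eq_sum_rowLen _ (hcol _ (le_of_mem_removeStrip (truncate_mem_removeStrip hi))),
      Finset.sum_range_succ, Finset.sum_range_succ, rowLen_truncate_of_interlace hi]
    have hsum : ∑ i ∈ Finset.range m, (truncate μ (f ν)).rowLen i =
        ∑ i ∈ Finset.range m, ν.rowLen i := Finset.sum_congr rfl fun i hi' => by
      rw [rowLen_truncate_of_interlace hi]
      exact Function.update_of_ne (Finset.mem_range.1 hi').ne _ _
    rw [hsum]
    simp only [f, Function.update_self]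
    omega
  refine Finset.sum_involution (fun ν _ => truncate μ (f ν)) ?_ ?_ ?_ ?_
  · intro ν hν
    obtain ⟨h1, h2, -, -, h3⟩ := hf ν hν
    rcases (by omega : (truncate μ (f ν)).card = ν.card + 1 ∨
      ν.card = (truncate μ (f ν)).card + 1) with h4 | h4
    all_goals rw [h4, pow_succ]; ring
  · intro ν hν _ heq
    obtain ⟨h1, h2, -, -, h3⟩ := hf ν hν
    rw [heq] at h3
    omega
  · intro ν hν
    obtain ⟨h1, h2, h3, h4, -⟩ := hf ν hν
    have hν' := (Finset.mem_filter.1 hν).2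
    refine Finset.mem_filter.2 ⟨truncate_mem_removeStrip h3, ?_⟩
    simp only [h4]
    have hsub : 2 * a + 1 - ν.rowLen m ≤ a + 1 ∧ a ≤ 2 * a + 1 - ν.rowLen m := by omega
    by_cases h0 : m = 0
    · rw [ha, if_pos h0] at hsub
      refine ⟨?_, ?_, fun i hi => ?_⟩
      · simp only [f, h0, Function.update_self]; rw [ha, if_pos h0, ← h0]; exact hsub.2
      · simp only [f, h0, Function.update_self]; rw [ha, if_pos h0, ← h0]; exact hsub.1
      · simp only [f]
        rw [Function.update_of_ne (by omega)]
        exact hν'.2.2 i hi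
    · have hf0 : f ν 0 = ν.rowLen 0 := Function.update_of_ne (Ne.symm h0) _ _
      rw [ha, if_neg h0] at hsub
      refine ⟨by rw [hf0]; exact hν'.1, by rw [hf0]; exact hν'.2.1, fun i hi => ?_⟩
      by_cases him : i = m
      · rw [him]
        simp only [f, Function.update_self]
        rw [ha, if_neg h0]
        exact hsub.1
      · simp only [f]
        rw [Function.update_of_ne him]
        exact hν'.2.2 i hi
  · intro ν hν
    obtain ⟨h1, h2, h3, h4, -⟩ := hf ν hν
    have hf2 : f (truncate μ (f ν)) = ν.rowLen := by
      ext i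
      by_cases him : i = m
      · rw [him]
        simp only [f, Function.update_self]
        rw [h4 m]
        simp only [f, Function.update_self]
        omega
      · simp only [f, Function.update_of_ne him]
        rw [h4 i]
        simp only [f, Function.update_of_ne him]
    refine young_ext fun i => ?_
    rw [hf2, rowLen_truncate_of_interlace (mem_removeStrip.1 (Finset.mem_filter.1 hν).1)]

/-- Pieri's rule for `e_N h_k`, in the form of its pairing with `s_μ`. -/
theorem alternating_count_young {k N : ℕ} (μ : YoungDiagram) (h : μ.card = N + k) :
    alternating N (fun l => youngSystem.count μ (l ++ [k])) = hookIndicator k μ := by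
  refine youngSystem.alternating_count (hookIndicator k) k (fun ν hν => count_singleton_young hν)
    (fun ν hν => ?_) (fun ν hν => sum_hookIndicator hν) N μ h
  have h1 := rowLen_zero_le_card ν
  simp only [youngSystem] at hν
  rw [hookIndicator, if_neg]
  omega

/-! ### Lexicographic triangularity of strip counts. -/

/-- The diagram `μ` without its first row. -/
def dropRow (μ : YoungDiagram) : YoungDiagram := truncate μ fun i => μ.rowLen (i + 1)

theorem dropRow_interlace (μ : YoungDiagram) (i : ℕ) :
    μ.rowLen (i + 1) ≤ μ.rowLen i ∧ μ.rowLen (i + 1) ≤ μ.rowLen (i + 1) :=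
  ⟨μ.rowLen_anti _ _ (Nat.le_succ i), le_rfl⟩

theorem rowLen_dropRow (μ : YoungDiagram) (i : ℕ) : (dropRow μ).rowLen i = μ.rowLen (i + 1) :=
  rowLen_truncate_of_interlace (dropRow_interlace μ) i

theorem card_dropRow (μ : YoungDiagram) : (dropRow μ).card + μ.rowLen 0 = μ.card := by
  rw [card_eq_sum_rowLen μ (M := μ.colLen 0 + 1) (by omega),
    card_eq_sum_rowLen (dropRow μ) (M := μ.colLen 0), Finset.sum_range_succ',
    Finset.sum_congr rfl fun i _ => rowLen_dropRow μ i]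
  rw [← rowLen_eq_zero_iff, rowLen_dropRow, rowLen_eq_zero_iff]
  omega

theorem dropRow_le {μ ν : YoungDiagram} (h : ν ∈ removeStrip μ) : dropRow μ ≤ ν :=
  young_le_iff.2 fun i => by rw [rowLen_dropRow]; exact (mem_removeStrip.1 h i).2

/-- What a horizontal strip leaves always contains `dropRow μ`, so no strip has more than `μ.rowLen
0` cells; equality forces the remainder to be `dropRow μ`, which gives the next lemma. -/
theorem count_young_cons_of_lt {μ : YoungDiagram} {r : ℕ} (h : μ.rowLen 0 < r) (l : List ℕ) :
    youngSystem.count μ (r :: l) = 0 := by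
  rw [StripSystem.count_cons]
  refine Finset.sum_eq_zero fun ν hν => ?_
  obtain ⟨hν, hc⟩ := Finset.mem_filter.1 hν
  simp only [youngSystem] at hc hν
  have h1 := Finset.card_le_card (YoungDiagram.cells_subset_iff.2 (dropRow_le hν))
  have h2 := card_dropRow μ
  change (dropRow μ).card ≤ ν.card at h1
  omega

theorem count_young_cons_rowLen (μ : YoungDiagram) (l : List ℕ) :
    youngSystem.count μ (μ.rowLen 0 :: l) = youngSystem.count (dropRow μ) l := by
  have h2 := card_dropRow μ
  rw [StripSystem.count_cons, Finset.sum_eq_single (dropRow μ)]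
  · intro ν hν hne
    obtain ⟨hν, hc⟩ := Finset.mem_filter.1 hν
    simp only [youngSystem] at hc hν
    exact absurd (young_eq_of_le_of_card (dropRow_le hν) (by omega)).symm hne
  · intro hn
    exact (hn (Finset.mem_filter.2 ⟨truncate_mem_removeStrip (dropRow_interlace μ), h2⟩)).elim

theorem count_young_eq_one (M : ℕ) (μ : YoungDiagram) (h : μ.rowLen M = 0) :
    youngSystem.count μ ((List.range M).map μ.rowLen) = 1 := by
  induction M generalizing μ with
  | zero =>
    rw [List.range_zero, List.map_nil, StripSystem.count_nil, if_pos]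
    have := card_eq_sum_rowLen μ (M := 0) (rowLen_eq_zero_iff.1 h)
    exact this.trans (Finset.sum_range_zero _)
  | succ M ih =>
    rw [List.range_succ_eq_map, List.map_cons, List.map_map, count_young_cons_rowLen]
    rw [← ih (dropRow μ) (by rw [rowLen_dropRow, h])]
    congr 2
    ext i
    rw [rowLen_dropRow]
    rfl

/-- The first strip is at most as long as the first row. If it is shorter, the lexicographic
comparison is decided; if it is equally long, the strip is forced and `dropRow μ` takes over. -/
theorem lex_of_count_young_ne_zero (M : ℕ) (μ : YoungDiagram) (g : ℕ → ℕ)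
    (h : youngSystem.count μ ((List.range M).map g) ≠ 0) :
    (∀ i < M, g i = μ.rowLen i) ∨ ∃ j < M, (∀ i < j, g i = μ.rowLen i) ∧ g j < μ.rowLen j := by
  induction M generalizing μ g with
  | zero => exact Or.inl fun i hi => absurd hi (Nat.not_lt_zero i)
  | succ M ih =>
    rw [List.range_succ_eq_map, List.map_cons, List.map_map] at h
    rcases lt_trichotomy (g 0) (μ.rowLen 0) with h0 | h0 | h0
    · exact Or.inr ⟨0, by omega, fun i hi => absurd hi (Nat.not_lt_zero i), h0⟩
    · rw [h0, count_young_cons_rowLen] at h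
      rcases ih (dropRow μ) (g ∘ Nat.succ) h with h1 | ⟨j, hj, h1, h2⟩
      · left
        intro i hi
        cases i with
        | zero => exact h0
        | succ i => rw [← rowLen_dropRow, ← h1 i (by omega)]; rfl
      · right
        refine ⟨j + 1, by omega, fun i hi => ?_, by rw [← rowLen_dropRow]; exact h2⟩
        cases i with
        | zero => exact h0
        | succ i => rw [← rowLen_dropRow, ← h1 i (by omega)]; rfl
    · exact absurd (count_young_cons_of_lt h0 _) h

theorem count_rowLens_self (μ : YoungDiagram) : youngSystem.count μ μ.rowLens = 1 :=
  count_young_eq_one _ μ (rowLen_eq_zero_iff.2 le_rfl)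

theorem rowLen_lex_of_count_ne_zero {μ ν : YoungDiagram} (hc : μ.card = ν.card)
    (h : youngSystem.count μ ν.rowLens ≠ 0) :
    ν = μ ∨ ∃ j, (∀ i < j, ν.rowLen i = μ.rowLen i) ∧ ν.rowLen j < μ.rowLen j := by
  rcases lex_of_count_young_ne_zero _ μ ν.rowLen h with h | ⟨j, -, h⟩
  · refine Or.inl (young_eq_of_le_of_card (young_le_iff.2 fun i => ?_) hc.symm)
    by_cases hi : i < ν.colLen 0
    · exact (h i hi).le
    · rw [rowLen_eq_zero_iff.2 (not_lt.1 hi)]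
      exact Nat.zero_le _
  · exact Or.inr ⟨j, h⟩

theorem sum_rowLens (μ : YoungDiagram) : μ.rowLens.sum = μ.card := by
  by_contra h
  -- A nonzero count already forces the sizes to agree.
  have := youngSystem.count_eq_zero (x := μ) (l := μ.rowLens) (Ne.symm h)
  rw [count_rowLens_self] at this
  exact one_ne_zero this

/-! ### Stable sets, colourings and acyclic orientations. -/

section Graph

variable {V : Type*} [DecidableEq V]

/-- No two vertices of `T` are adjacent. -/
def IsStable (G : SimpleGraph V) (T : Finset V) : Prop := ∀ u ∈ T, ∀ v ∈ T, ¬ G.Adj u v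

open scoped Classical in
/-- The sets of vertices obtained from `A` by removing a stable set. -/
def removeStable (G : SimpleGraph V) (A : Finset V) : Finset (Finset V) :=
  A.powerset.filter fun B => IsStable G (A \ B)

theorem mem_removeStable {G : SimpleGraph V} {A B : Finset V} :
    B ∈ removeStable G A ↔ B ⊆ A ∧ IsStable G (A \ B) := by
  classical
  rw [removeStable, Finset.mem_filter, Finset.mem_powerset]

/-- Removal of stable sets from sets of vertices. -/
def graphSystem (G : SimpleGraph V) : StripSystem (Finset V) where
  strips := removeStable G
  size := Finset.card
  size_le h := Finset.card_le_card (mem_removeStable.1 h).1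
  self_mem A := mem_removeStable.2 ⟨subset_rfl, by simp [IsStable]⟩
  eq_of_size_eq h hc := Finset.eq_of_subset_of_card_le (mem_removeStable.1 h).1 hc.ge
  flip A B C := C ∪ (A \ B)
  flip_mem {A B C} hB hC := by
    rw [mem_removeStable] at *
    refine ⟨Finset.union_subset (hC.1.trans hB.1) Finset.sdiff_subset, fun u hu v hv => ?_⟩
    refine hC.2 u ?_ v ?_
    all_goals simp only [Finset.mem_sdiff, Finset.mem_union] at hu hv ⊢
    all_goals tauto
  mem_flip {A B C} hB hC := by
    rw [mem_removeStable] at *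
    refine ⟨Finset.subset_union_left, fun u hu v hv => ?_⟩
    refine hB.2 u ?_ v ?_
    all_goals simp only [Finset.mem_sdiff, Finset.mem_union] at hu hv ⊢
    all_goals tauto
  size_flip {A B C} hB hC := by
    rw [mem_removeStable] at hB hC
    rw [Finset.card_union_of_disjoint, add_assoc, Finset.card_sdiff_add_card_eq_card hB.1, add_comm]
    exact Finset.disjoint_sdiff.mono_left hC.1
  flip_flip {A B C} hB hC := by
    rw [mem_removeStable] at hB hC
    ext u
    have h1 := @hB.1 u
    have h2 := @hC.1 u
    simp only [Finset.mem_sdiff, Finset.mem_union]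
    tauto

/-- Proper colourings of sets of vertices. -/
def graphModel (G : SimpleGraph V) : FillingModel (graphSystem G) V where
  cells := id
  valid A κ := (∀ u ∈ A, ∀ v ∈ A, G.Adj u v → κ u ≠ κ v) ∧ ∀ v ∉ A, κ v = 0
  card_cells _ := rfl
  cells_injective := Function.injective_id
  cells_subset h := (mem_removeStable.1 h).1
  apply_eq_zero h hc := h.2 _ hc
  valid_zero {A} h := by
    change A = ∅ at h
    subst h
    exact ⟨fun _ h => absurd h (Finset.notMem_empty _), fun _ _ => rfl⟩
  restrict {A κ N} := by
    rintro ⟨hκ, h0⟩ hN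
    refine ⟨A.filter fun v => κ v < N, mem_removeStable.2 ⟨Finset.filter_subset _ _, ?_⟩,
      fun c => Finset.mem_filter, fun κ' h1 h2 => ⟨fun u hu v hv huv => ?_, h2⟩⟩
    · intro u hu v hv huv
      simp only [Finset.mem_sdiff, Finset.mem_filter, not_and, not_lt] at hu hv
      exact hκ u hu.1 v hv.1 huv
        ((le_antisymm (hN u hu.1) (hu.2 hu.1)).trans (le_antisymm (hN v hv.1) (hv.2 hv.1)).symm)
    · rw [h1 u hu, h1 v hv]
      exact hκ u (Finset.mem_filter.1 hu).1 v (Finset.mem_filter.1 hv).1 huv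
  extend {A B κ N} := by
    rintro hB ⟨hκ, -⟩ hN κ' h1 h2 h3
    obtain ⟨-, hst⟩ := mem_removeStable.1 hB
    refine ⟨fun u hu v hv huv => ?_, h3⟩
    by_cases huB : u ∈ B
    · by_cases hvB : v ∈ B
      · rw [h1 u huB, h1 v hvB]
        exact hκ u huB v hvB huv
      · rw [h1 u huB, h2 v hv hvB]
        exact (hN u huB).ne
    · by_cases hvB : v ∈ B
      · rw [h2 u hu huB, h1 v hvB]
        exact (hN v hvB).ne'
      · exact absurd huv (hst u (Finset.mem_sdiff.2 ⟨hu, huB⟩) v (Finset.mem_sdiff.2 ⟨hv, hvB⟩))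

variable [Fintype V]

theorem chromaticSymm_exponent (G : SimpleGraph V) (l : List ℕ) :
    chromaticSymm G (exponent l) = (graphSystem G).count Finset.univ l := by
  rw [← (graphModel G).ncard_fillings_exponent]
  change (Nat.card _ : ℤ) = (Nat.card _ : ℤ)
  congr 1
  refine Nat.card_congr
    { toFun := fun κ => ⟨fun v => κ.1 v, ⟨fun u _ v _ h => κ.1.valid h,
        fun v hv => absurd (Finset.mem_univ v) hv⟩, κ.2⟩
      invFun := fun κ => ⟨SimpleGraph.Coloring.mk κ.1
        fun {u v} h => κ.2.1.1 u (Finset.mem_univ u) v (Finset.mem_univ v) h, κ.2.2⟩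
      left_inv := fun κ => rfl
      right_inv := fun κ => rfl }

/-- The graph on `V` with the edges of `G` joining two vertices of `A`. -/
def restrictTo {W : Type*} (G : SimpleGraph W) (A : Finset W) : SimpleGraph W where
  Adj u v := G.Adj u v ∧ u ∈ A ∧ v ∈ A
  symm := ⟨fun _ _ h => ⟨h.1.symm, h.2.2, h.2.1⟩⟩
  loopless := ⟨fun _ h => G.loopless.irrefl _ h.1⟩

theorem finite_digraph {W : Type*} [Finite W] : Finite (Digraph W) :=
  Finite.of_injective (fun D : Digraph W => D.Adj) fun _ _ h => Digraph.ext h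

/-- The acyclic orientations of the subgraph induced on `A`. -/
def acyclicOrientations {W : Type*} [Finite W] (G : SimpleGraph W) (A : Finset W) :
    Finset (Digraph W) :=
  have := finite_digraph (W := W)
  (Set.toFinite {D | IsOrientation (restrictTo G A) D ∧ IsAcyclic D}).toFinset

theorem mem_acyclicOrientations {W : Type*} [Finite W] {G : SimpleGraph W} {A : Finset W}
    {D : Digraph W} :
    D ∈ acyclicOrientations G A ↔ IsOrientation (restrictTo G A) D ∧ IsAcyclic D := by
  rw [acyclicOrientations, Set.Finite.mem_toFinset, Set.mem_ofPred_eq]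

open scoped Classical in
/-- The sinks of `D` lying in `A`. -/
def sinksIn (D : Digraph V) (A : Finset V) : Finset V := A.filter (· ∈ sinks D)

theorem mem_sinksIn {W : Type*} {D : Digraph W} {A : Finset W} {v : W} :
    v ∈ sinksIn D A ↔ v ∈ A ∧ v ∈ sinks D := by
  classical
  rw [sinksIn, Finset.mem_filter]

theorem isStable_of_subset_sinksIn {V : Type*} [Fintype V] {G : SimpleGraph V} {A T : Finset V} {D : Digraph V}
    (hD : D ∈ acyclicOrientations G A) (hT : T ⊆ sinksIn D A) : IsStable G T := by
  intro u hu v hv huv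
  have hu := mem_sinksIn.1 (hT hu)
  have hv := mem_sinksIn.1 (hT hv)
  rcases (mem_acyclicOrientations.1 hD).1.2 u v ⟨huv, hu.1, hv.1⟩ with h | h
  exacts [hu.2 v h.1, hv.2 u h.1]

theorem subset_sinksIn {W : Type*} {A T : Finset W} {D : Digraph W} :
    T ⊆ sinksIn D A ↔ T ⊆ A ∧ ∀ u ∈ T, ∀ w, ¬ D.Adj u w := by
  simp only [Finset.subset_iff, mem_sinksIn, forall_and]
  rfl

theorem sinksIn_nonempty {V : Type*} [Fintype V] {G : SimpleGraph V} {A : Finset V} {D : Digraph V}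
    (hD : D ∈ acyclicOrientations G A) (hA : A.Nonempty) : (sinksIn D A).Nonempty := by
  obtain ⟨ho, ha⟩ := mem_acyclicOrientations.1 hD
  let r : V → V → Prop := fun u v => Relation.TransGen D.Adj v u
  have : IsTrans V r := ⟨fun _ _ _ h1 h2 => h2.trans h1⟩
  have : Std.Irrefl r := ⟨ha⟩
  obtain ⟨m, hm, hmin⟩ := (Finite.wellFounded_of_trans_of_irrefl r).has_min (A : Set V) hA
  refine ⟨m, mem_sinksIn.2 ⟨hm, fun w hw => ?_⟩⟩
  exact hmin w (ho.1 m w hw).2.2 (Relation.TransGen.single hw)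

/-- If all of `T` consists of sinks, the arrows at `T` are forced to point into `T`; deleting them
loses no information, and restoring them creates no cycle, since no walk leaves `T`. -/
theorem card_filter_subset_sinksIn {G : SimpleGraph V} {A T : Finset V} (hTA : T ⊆ A)
    (hT : IsStable G T) : {D ∈ acyclicOrientations G A | T ⊆ sinksIn D A}.card =
      (acyclicOrientations G (A \ T)).card := by
  refine Finset.card_nbij' (fun D => ⟨fun u v => D.Adj u v ∧ v ∉ T⟩)
    (fun D => ⟨fun u v => D.Adj u v ∨ G.Adj u v ∧ u ∈ A ∧ v ∈ T⟩) ?_ ?_ ?_ ?_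
  · intro D hD
    obtain ⟨hD, hs⟩ := Finset.mem_filter.1 hD
    obtain ⟨ho, ha⟩ := mem_acyclicOrientations.1 hD
    rw [subset_sinksIn] at hs
    refine mem_acyclicOrientations.2 ⟨⟨fun u v h => ?_, fun u v h => ?_⟩, fun v h => ha v ?_⟩
    · have h1 := ho.1 u v h.1
      exact ⟨h1.1, Finset.mem_sdiff.2 ⟨h1.2.1, fun hu => hs.2 u hu v h.1⟩,
        Finset.mem_sdiff.2 ⟨h1.2.2, h.2⟩⟩
    · obtain ⟨huv, hu, hv⟩ := h
      rw [Finset.mem_sdiff] at hu hv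
      have := ho.2 u v ⟨huv, hu.1, hv.1⟩
      simpa only [hu.2, hv.2, not_false_eq_true, and_true] using this
    · exact Relation.TransGen.mono (fun _ _ h => h.1) _ _ h
  · intro D hD
    obtain ⟨ho, ha⟩ := mem_acyclicOrientations.1 hD
    have hs : ∀ u ∈ T, ∀ w, ¬ (D.Adj u w ∨ G.Adj u w ∧ u ∈ A ∧ w ∈ T) := by
      rintro u hu w (h | h)
      · exact (Finset.mem_sdiff.1 (ho.1 u w h).2.1).2 hu
      · exact hT u hu w h.2.2 h.1
    refine Finset.mem_filter.2 ⟨mem_acyclicOrientations.2 ⟨⟨?_, ?_⟩, ?_⟩,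
      subset_sinksIn.2 ⟨hTA, hs⟩⟩
    · rintro u v (h | h)
      · have h1 := ho.1 u v h
        exact ⟨h1.1, (Finset.mem_sdiff.1 h1.2.1).1, (Finset.mem_sdiff.1 h1.2.2).1⟩
      · exact ⟨h.1, h.2.1, hTA h.2.2⟩
    · rintro u v ⟨huv, hu, hv⟩
      by_cases huT : u ∈ T
      · exact Or.inr ⟨Or.inr ⟨huv.symm, hv, huT⟩, hs u huT v⟩
      · by_cases hvT : v ∈ T
        · exact Or.inl ⟨Or.inr ⟨huv, hu, hvT⟩, hs v hvT u⟩
        · have := ho.2 u v ⟨huv, Finset.mem_sdiff.2 ⟨hu, huT⟩, Finset.mem_sdiff.2 ⟨hv, hvT⟩⟩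
          simpa only [huT, hvT, and_false, or_false] using this
    · intro v hv
      -- A walk that ends outside `T` never enters `T`, hence uses only arrows of `D`.
      have key : ∀ a b, Relation.TransGen
          (fun u v => D.Adj u v ∨ G.Adj u v ∧ u ∈ A ∧ v ∈ T) a b → b ∉ T →
          Relation.TransGen D.Adj a b := by
        intro a b hab
        induction hab with
        | single h =>
          intro hb
          exact Relation.TransGen.single (h.resolve_right fun h => hb h.2.2)
        | @tail b c _ h ih =>
          intro hc
          exact (ih fun hb => hs b hb c h).tail (h.resolve_right fun h => hc h.2.2)
      refine ha v (key v v hv fun hvT => ?_)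
      obtain ⟨w, hw, -⟩ := Relation.TransGen.head'_iff.1 hv
      exact hs v hvT w hw
  · intro D hD
    obtain ⟨hD, hs⟩ := Finset.mem_filter.1 hD
    obtain ⟨ho, ha⟩ := mem_acyclicOrientations.1 hD
    rw [subset_sinksIn] at hs
    refine Digraph.ext ?_
    ext u v
    constructor
    · rintro (h | ⟨h, hu, hv⟩)
      · exact h.1
      · rcases ho.2 u v ⟨h, hu, hTA hv⟩ with h | h
        · exact h.1
        · exact absurd h.1 (hs.2 v hv u)
    · intro h
      by_cases hv : v ∈ T
      · have := ho.1 u v h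
        exact Or.inr ⟨this.1, this.2.1, hv⟩
      · exact Or.inl ⟨h, hv⟩
  · intro D hD
    obtain ⟨ho, ha⟩ := mem_acyclicOrientations.1 hD
    refine Digraph.ext ?_
    ext u v
    constructor
    · rintro ⟨h | h, hv⟩
      · exact h
      · exact absurd h.2.2 hv
    · intro h
      exact ⟨Or.inl h, (Finset.mem_sdiff.1 (ho.1 u v h).2.2).2⟩

/-- An acyclic orientation of `B` is one of `A` whose sinks include `T = A \ B`. For a fixed
orientation of `A` the sum over `T` is then the signed count of all subsets of its sink set (sets of
sinks being automatically stable), and that set is nonempty. -/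
theorem sum_removeStable_card_acyclicOrientations (G : SimpleGraph V) {A : Finset V}
    (hA : A.Nonempty) :
    ∑ B ∈ removeStable G A, (-1 : ℤ) ^ B.card * ((acyclicOrientations G B).card : ℤ) = 0 := by
  classical
  have h1 : ∑ B ∈ removeStable G A, (-1 : ℤ) ^ B.card * ((acyclicOrientations G B).card : ℤ) =
      ∑ T ∈ A.powerset, ∑ D ∈ acyclicOrientations G A,
        if T ⊆ sinksIn D A then (-1 : ℤ) ^ A.card * (-1) ^ T.card else 0 := by
    rw [← Finset.sum_filter_of_ne (s := A.powerset) (p := IsStable G)]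
    · refine Finset.sum_nbij' (fun B => A \ B) (fun T => A \ T) ?_ ?_ ?_ ?_ ?_
      · intro B hB
        exact Finset.mem_filter.2
          ⟨Finset.mem_powerset.2 Finset.sdiff_subset, (mem_removeStable.1 hB).2⟩
      · intro T hT
        rw [Finset.mem_filter, Finset.mem_powerset] at hT
        exact mem_removeStable.2
          ⟨Finset.sdiff_subset, by rw [Finset.sdiff_sdiff_eq_self hT.1]; exact hT.2⟩
      · intro B hB
        exact Finset.sdiff_sdiff_eq_self (mem_removeStable.1 hB).1
      · intro T hT
        rw [Finset.mem_filter, Finset.mem_powerset] at hT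
        exact Finset.sdiff_sdiff_eq_self hT.1
      · intro B hB
        obtain ⟨hBA, hst⟩ := mem_removeStable.1 hB
        rw [← Finset.sum_filter, Finset.sum_const,
          card_filter_subset_sinksIn Finset.sdiff_subset hst, Finset.sdiff_sdiff_eq_self hBA,
          nsmul_eq_mul, mul_comm, ← Finset.card_sdiff_add_card_eq_card hBA, pow_add,
          mul_right_comm, ← pow_add, Even.neg_one_pow ⟨_, rfl⟩, one_mul]
    · intro T _ hne
      by_contra hT
      refine hne (Finset.sum_eq_zero fun D hD => if_neg fun hs => hT ?_)
      exact isStable_of_subset_sinksIn hD hs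
  rw [h1, Finset.sum_comm]
  refine Finset.sum_eq_zero fun D hD => ?_
  rw [← Finset.sum_filter, ← Finset.mul_sum]
  have h2 : A.powerset.filter (fun T => T ⊆ sinksIn D A) = (sinksIn D A).powerset := by
    ext T
    simp only [Finset.mem_filter, Finset.mem_powerset]
    exact ⟨fun h => h.2, fun h => ⟨(subset_sinksIn.1 h).1, h⟩⟩
  rw [h2, Finset.sum_powerset_neg_one_pow_card_of_nonempty (sinksIn_nonempty hD hA), mul_zero]

/-- The number of pairs of an acyclic orientation of the subgraph induced on `A` and a set of `k`
of its sinks. -/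
def sinkPairs (G : SimpleGraph V) (k : ℕ) (A : Finset V) : ℤ :=
  ∑ D ∈ acyclicOrientations G A, ((sinksIn D A).card.choose k : ℤ)

-- Choosing the marked sinks first leaves an arbitrary acyclic orientation of the rest.
open scoped Classical in
theorem sinkPairs_eq (G : SimpleGraph V) (k : ℕ) (A : Finset V) :
    sinkPairs G k A = ∑ T ∈ A.powersetCard k with IsStable G T,
      ((acyclicOrientations G (A \ T)).card : ℤ) := by
  have h1 : ∀ D ∈ acyclicOrientations G A, ((sinksIn D A).card.choose k : ℤ) =
      ∑ T ∈ A.powersetCard k with IsStable G T, if T ⊆ sinksIn D A then 1 else 0 := by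
    intro D hD
    rw [← Finset.card_powersetCard, ← Finset.sum_filter, Finset.sum_const, nsmul_eq_mul, mul_one]
    congr 2
    ext T
    simp only [Finset.mem_filter, Finset.mem_powersetCard]
    exact ⟨fun h => ⟨⟨⟨(subset_sinksIn.1 h.1).1, h.2⟩, isStable_of_subset_sinksIn hD h.1⟩, h.1⟩,
      fun h => ⟨h.2, h.1.1.2⟩⟩
  rw [sinkPairs, Finset.sum_congr rfl h1, Finset.sum_comm]
  refine Finset.sum_congr rfl fun T hT => ?_
  rw [Finset.mem_filter, Finset.mem_powersetCard] at hT
  rw [← card_filter_subset_sinksIn hT.1.1 hT.2, ← Finset.sum_filter, Finset.sum_const,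
    nsmul_eq_mul, mul_one]

theorem sinkPairs_eq_zero {G : SimpleGraph V} {k : ℕ} {A : Finset V} (h : A.card < k) :
    sinkPairs G k A = 0 := by
  classical
  rw [sinkPairs_eq, Finset.powersetCard_eq_empty.2 h]
  rfl

theorem sum_removeStable_sinkPairs (G : SimpleGraph V) {k : ℕ} {A : Finset V} (h : k < A.card) :
    ∑ B ∈ removeStable G A, (-1) ^ B.card * sinkPairs G k B = 0 := by
  classical
  have h1 : ∑ B ∈ removeStable G A, (-1) ^ B.card * sinkPairs G k B =
      ∑ T ∈ A.powersetCard k with IsStable G T, ∑ C ∈ removeStable G (A \ T),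
        (-1) ^ k * ((-1) ^ C.card * ((acyclicOrientations G C).card : ℤ)) := by
    simp_rw [sinkPairs_eq, Finset.mul_sum]
    rw [Finset.sum_sigma', Finset.sum_sigma']
    -- Fix the marked set `T` first and put `C = B \ T`: the removed stable set is unchanged, as `(A
    -- \ T) \ C = A \ B`. For each `T` the unmarked identity applies to `A \ T`, nonempty because `k
    -- < A.card`.
    refine Finset.sum_nbij' (fun p => ⟨p.2, p.1 \ p.2⟩) (fun p => ⟨p.2 ∪ p.1, p.1⟩) ?_ ?_ ?_ ?_ ?_
    all_goals
      rintro ⟨B, T⟩ hp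
      simp only [Finset.mem_sigma, Finset.mem_filter, Finset.mem_powersetCard,
        mem_removeStable] at hp ⊢
    · obtain ⟨⟨hBA, hB⟩, ⟨hTB, hk⟩, hT⟩ := hp
      refine ⟨⟨⟨hTB.trans hBA, hk⟩, hT⟩, Finset.sdiff_subset_sdiff hBA subset_rfl, ?_⟩
      convert hB using 1
      ext u
      have := @hTB u
      simp only [Finset.mem_sdiff]
      tauto
    · obtain ⟨⟨⟨hBA, hk⟩, hB⟩, hTA, hT⟩ := hp
      refine ⟨⟨Finset.union_subset (hTA.trans Finset.sdiff_subset) hBA, ?_⟩,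
        ⟨Finset.subset_union_right, hk⟩, hB⟩
      convert hT using 1
      ext u
      simp only [Finset.mem_sdiff, Finset.mem_union]
      tauto
    · rw [Finset.sdiff_union_of_subset hp.2.1.1]
    · rw [Finset.union_sdiff_cancel_right]
      exact Finset.sdiff_disjoint.mono_left hp.2.1
    · rw [← Finset.card_sdiff_add_card_eq_card hp.2.1.1, hp.2.1.2, pow_add]
      ring
  rw [h1]
  refine Finset.sum_eq_zero fun T hT => ?_
  rw [Finset.mem_filter, Finset.mem_powersetCard] at hT
  rw [← Finset.mul_sum, sum_removeStable_card_acyclicOrientations, mul_zero]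
  rw [← Finset.card_pos, Finset.card_sdiff_of_subset hT.1.1]
  omega

theorem card_acyclicOrientations_empty {V : Type*} [Fintype V] (G : SimpleGraph V) :
    (acyclicOrientations G ∅).card = 1 := by
  rw [Finset.card_eq_one]
  refine ⟨⟨fun _ _ => False⟩, Finset.eq_singleton_iff_unique_mem.2 ⟨?_, fun D hD => ?_⟩⟩
  · refine mem_acyclicOrientations.2 ⟨⟨fun _ _ h => h.elim, fun u v h => ?_⟩, fun v h => ?_⟩
    · exact absurd h.2.1 (Finset.notMem_empty _)
    · obtain ⟨_, h, -⟩ := Relation.TransGen.head'_iff.1 h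
      exact h
  · refine Digraph.ext ?_
    ext u v
    refine ⟨fun h => ?_, fun h => h.elim⟩
    exact absurd ((mem_acyclicOrientations.1 hD).1.1 u v h).2.1 (Finset.notMem_empty _)

theorem count_singleton_graph {G : SimpleGraph V} {A : Finset V} {k : ℕ} (h : A.card = k) :
    (graphSystem G).count A [k] = sinkPairs G k A := by
  classical
  subst h
  rw [StripSystem.count_cons, sinkPairs_eq, Finset.powersetCard_self, Finset.filter_singleton]
  have h1 : ∀ B ∈ (graphSystem G).strips A, (graphSystem G).size B + A.card =
      (graphSystem G).size A → B = ∅ := by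
    intro B _ hB
    simp only [graphSystem] at hB
    exact Finset.card_eq_zero.1 (by omega)
  by_cases hA : IsStable G A
  · rw [if_pos hA, Finset.sum_singleton, Finset.sdiff_self, card_acyclicOrientations_empty,
      Finset.sum_eq_single ∅, StripSystem.count_nil, if_pos]
    · rfl
    · exact Finset.card_empty (α := V)
    · intro B hB hne
      rw [Finset.mem_filter] at hB
      exact absurd (h1 B hB.1 hB.2) hne
    · intro hn
      refine absurd (Finset.mem_filter.2 ⟨mem_removeStable.2 ⟨Finset.empty_subset _, ?_⟩, ?_⟩) hn
      · rwa [Finset.sdiff_empty]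
      · simp [graphSystem]
  · rw [if_neg hA, Finset.sum_empty]
    refine Finset.sum_eq_zero fun B hB => absurd ?_ hA
    rw [Finset.mem_filter] at hB
    have h2 := (mem_removeStable.1 hB.1).2
    rwa [h1 B hB.1 hB.2, Finset.sdiff_empty] at h2

theorem alternating_count_graph (G : SimpleGraph V) {k N : ℕ} (A : Finset V)
    (h : A.card = N + k) :
    alternating N (fun l => (graphSystem G).count A (l ++ [k])) = sinkPairs G k A :=
  (graphSystem G).alternating_count (sinkPairs G k) k (fun _ h => count_singleton_graph h)
    (fun _ h => sinkPairs_eq_zero h) (fun _ h => sum_removeStable_sinkPairs G h) N A h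

theorem sinkPairs_univ {V : Type*} [Fintype V] (G : SimpleGraph V) {k : ℕ} (hk : 1 ≤ k) :
    sinkPairs G k Finset.univ =
      ∑ j ∈ Finset.Icc 1 (Fintype.card V), (j.choose k : ℤ) * (numAcyclic G j : ℤ) := by
  classical
  have hG : restrictTo G Finset.univ = G := by
    ext u v
    simp [restrictTo]
  have hs : ∀ D : Digraph V, (sinksIn D Finset.univ).card = (sinks D).ncard := by
    intro D
    rw [← Set.ncard_coe_finset]
    congr 1
    ext v
    simp [sinksIn]
  have hn : ∀ j, (numAcyclic G j : ℤ) =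
      ({D ∈ acyclicOrientations G Finset.univ | (sinksIn D Finset.univ).card = j}.card : ℤ) := by
    intro j
    rw [numAcyclic]
    congr 1
    rw [← Set.ncard_coe_finset]
    change Nat.card _ = Nat.card _
    refine Nat.card_congr (Equiv.subtypeEquivRight fun D => ?_)
    rw [Finset.mem_coe, Finset.mem_filter, mem_acyclicOrientations, hG, hs, and_assoc]
  have h0 : ∑ j ∈ Finset.Icc 1 (Fintype.card V), (j.choose k : ℤ) * (numAcyclic G j : ℤ) =
      ∑ j ∈ Finset.range (Fintype.card V + 1), (j.choose k : ℤ) * (numAcyclic G j : ℤ) := by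
    refine Finset.sum_subset (fun j hj => ?_) fun j _ hj' => ?_
    · rw [Finset.mem_Icc] at hj
      exact Finset.mem_range.2 (by omega)
    · rw [Finset.mem_Icc] at hj'
      rw [Finset.mem_range] at *
      -- The term `j = 0` vanishes since `k ≥ 1`.
      have : j = 0 := by omega
      rw [this, Nat.choose_eq_zero_of_lt hk]
      simp
  rw [h0, sinkPairs, ← Finset.sum_fiberwise_of_maps_to
    (s := acyclicOrientations G Finset.univ) (g := fun D => (sinksIn D Finset.univ).card)
    (t := Finset.range (Fintype.card V + 1))]
  · refine Finset.sum_congr rfl fun j _ => ?_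
    rw [hn, Finset.sum_congr rfl fun D hD => by rw [(Finset.mem_filter.1 hD).2], Finset.sum_const,
      nsmul_eq_mul, mul_comm]
  · intro D _
    exact Finset.mem_range.2 (Nat.lt_succ_of_le (Finset.card_le_univ _))

end Graph

/-! ### The Kostka matrix. -/

/-- Sorting the nonzero entries yields a partition, so by symmetry strip counts are determined by
their values on row length lists. -/
theorem exists_perm_rowLens (l : List ℕ) :
    ∃ ν : YoungDiagram, ν.card = l.sum ∧ (l.filter (· ≠ 0)).Perm ν.rowLens := by
  have hp := List.perm_insertionSort (· ≥ ·) (l.filter (· ≠ 0))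
  have hs : ((l.filter (· ≠ 0)).insertionSort (· ≥ ·)).SortedGE :=
    List.sortedGE_insertionSort
  have hpos : ∀ x ∈ (l.filter (· ≠ 0)).insertionSort (· ≥ ·), 0 < x := by
    intro x hx
    have := (List.mem_filter.1 (hp.subset hx)).2
    exact Nat.pos_of_ne_zero (by simpa using this)
  have hrow := YoungDiagram.rowLens_ofRowLens_eq_self (hw := hs) hpos
  refine ⟨YoungDiagram.ofRowLens _ hs, ?_, by rw [hrow]; exact hp.symm⟩
  rw [← sum_rowLens, hrow, hp.sum_eq]
  clear hp hs hpos hrow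
  induction l with
  | nil => rfl
  | cons r l ih => by_cases hr : r = 0 <;> simp_all

theorem StripSystem.count_eq_of_perm {P : Type*} (S : StripSystem P) {l l' : List ℕ}
    (h : (l.filter (· ≠ 0)).Perm l') (x : P) : S.count x l = S.count x l' := by
  rw [← S.count_filter, S.count_perm h]

theorem finite_diagrams (n : ℕ) : {μ : YoungDiagram | μ.card = n}.Finite := by
  refine ((Finset.range n ×ˢ Finset.range n).powerset.finite_toSet.preimage
    (Function.Injective.injOn (f := YoungDiagram.cells) fun _ _ h => YoungDiagram.ext h)).subset ?_
  rintro μ rfl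
  refine Finset.mem_coe.2 (Finset.mem_powerset.2 ?_)
  rintro ⟨i, j⟩ hc
  have h1 : μ.rowLen i ≤ μ.card := by
    rw [YoungDiagram.rowLen_eq_card]
    exact Finset.card_le_card (Finset.filter_subset _ _)
  have h2 : μ.colLen j ≤ μ.card := by
    rw [YoungDiagram.colLen_eq_card]
    exact Finset.card_le_card (Finset.filter_subset _ _)
  have h3 := YoungDiagram.mem_iff_lt_rowLen.1 hc
  have h4 := YoungDiagram.mem_iff_lt_colLen.1 hc
  exact Finset.mem_product.2 ⟨Finset.mem_range.2 (by simp only; omega),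
    Finset.mem_range.2 (by simp only; omega)⟩

/-- The Young diagrams with `n` cells. -/
def diagrams (n : ℕ) : Finset YoungDiagram := (finite_diagrams n).toFinset

theorem mem_diagrams {n : ℕ} {μ : YoungDiagram} : μ ∈ diagrams n ↔ μ.card = n := by
  rw [diagrams, Set.Finite.mem_toFinset, Set.mem_ofPred_eq]

/-- The Kostka matrix in degree `n`. -/
def kostka (n : ℕ) : Matrix (diagrams n) (diagrams n) ℤ :=
  Matrix.of fun ν μ => youngSystem.count μ.1 ν.1.rowLens

-- In the lexicographic order on row lengths the matrix is upper triangular with unit diagonal, so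
-- it is invertible over the integers.
open scoped Classical in
theorem det_kostka (n : ℕ) : (kostka n).det = 1 := by
  have hinj : Function.Injective fun μ : diagrams n => toLex μ.1.rowLen := by
    intro μ ν h
    exact Subtype.ext (young_ext fun i => congrFun (toLex.injective h) i)
  let ord : LinearOrder (diagrams n) := LinearOrder.lift' _ hinj
  have := Matrix.det_of_isUpperTriangular (M := kostka n) <| by
    intro ν μ hlt
    by_contra hne
    have hlt' : toLex μ.1.rowLen < toLex ν.1.rowLen := hlt
    rcases rowLen_lex_of_count_ne_zero
      ((mem_diagrams.1 μ.2).trans (mem_diagrams.1 ν.2).symm) hne with h | ⟨j, h⟩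
    · rw [h] at hlt'
      exact lt_irrefl _ hlt'
    · exact lt_asymm hlt' ⟨j, h⟩
  rw [Finset.prod_eq_one fun ν _ => count_rowLens_self ν.1] at this
  convert this

theorem exists_kostka_eq (n : ℕ) (b : YoungDiagram → ℤ) : ∃ a : YoungDiagram → ℤ,
    (∀ μ ∉ diagrams n, a μ = 0) ∧
      ∀ ν ∈ diagrams n, ∑ μ ∈ diagrams n, a μ * youngSystem.count μ ν.rowLens = b ν := by
  classical
  have hu : IsUnit (kostka n).det := by rw [det_kostka]; exact isUnit_one
  set a' := (kostka n)⁻¹.mulVec fun ν => b ν.1 with ha'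
  have hM : (kostka n).mulVec a' = fun ν => b ν.1 := by
    rw [ha', Matrix.mulVec_mulVec, Matrix.mul_nonsing_inv _ hu, Matrix.one_mulVec]
  refine ⟨fun μ => if h : μ ∈ diagrams n then a' ⟨μ, h⟩ else 0, fun μ h => dif_neg h,
    fun ν hν => ?_⟩
  rw [← congrFun hM ⟨ν, hν⟩, ← Finset.sum_coe_sort]
  refine Finset.sum_congr rfl fun μ _ => ?_
  simp only [dif_pos μ.2, kostka, Matrix.of_apply]
  exact mul_comm _ _

theorem kostka_injective (n : ℕ) {a a' : YoungDiagram → ℤ}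
    (h : ∀ ν ∈ diagrams n, ∑ μ ∈ diagrams n, a μ * youngSystem.count μ ν.rowLens =
      ∑ μ ∈ diagrams n, a' μ * youngSystem.count μ ν.rowLens) {μ : YoungDiagram}
    (hμ : μ ∈ diagrams n) : a μ = a' μ := by
  classical
  have hu : IsUnit (kostka n).det := by rw [det_kostka]; exact isUnit_one
  have hM : (kostka n).mulVec (fun μ => a μ.1) = (kostka n).mulVec (fun μ => a' μ.1) := by
    ext ν
    have := h ν.1 ν.2
    rw [← Finset.sum_coe_sort (diagrams n), ← Finset.sum_coe_sort (diagrams n)] at this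
    simp only [Matrix.mulVec, dotProduct, kostka, Matrix.of_apply]
    simp only [mul_comm] at this ⊢
    exact this
  have h2 := congrArg (kostka n)⁻¹.mulVec hM
  rw [Matrix.mulVec_mulVec, Matrix.mulVec_mulVec, Matrix.nonsing_inv_mul _ hu, Matrix.one_mulVec,
    Matrix.one_mulVec] at h2
  exact congrFun h2 ⟨μ, hμ⟩

theorem sum_support_eq (c : YoungDiagram →₀ ℤ) (l : List ℕ) :
    ∑ μ ∈ c.support, c μ * youngSystem.count μ l =
      ∑ μ ∈ diagrams l.sum, c μ * youngSystem.count μ l := by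
  classical
  refine Finset.sum_congr_of_eq_on_inter (fun μ _ h => ?_) (fun μ _ h => ?_) fun _ _ _ => rfl
  · rw [mem_diagrams] at h
    rw [youngSystem.count_eq_zero h, mul_zero]
  · rw [Finsupp.notMem_support_iff.1 h, zero_mul]

theorem sum_smul_schur_apply (c : YoungDiagram →₀ ℤ) (d : ℕ →₀ ℕ) :
    (c.sum fun μ a => a • schur μ) d = ∑ μ ∈ c.support, c μ * schur μ d := by
  change MvPowerSeries.coeff d (∑ μ ∈ c.support, c μ • schur μ) = _
  rw [map_sum]
  refine Finset.sum_congr rfl fun μ _ => ?_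
  rw [map_zsmul, smul_eq_mul]
  rfl

/-! ### Hook shapes. -/

theorem hook_mem_iff {k m : ℕ} {hk : 1 ≤ k} {i j : ℕ} :
    (i, j) ∈ hook k m hk ↔ (i = 0 ∧ j < k) ∨ (1 ≤ i ∧ i ≤ m ∧ j = 0) := by
  rw [hook, YoungDiagram.mem_ofRowLens]
  cases i with
  | zero => simp
  | succ i =>
    simp only [List.length_cons, List.length_replicate, List.getElem_cons_succ,
      List.getElem_replicate]
    constructor
    · rintro ⟨h1, h2⟩
      exact Or.inr ⟨by omega, by omega, by omega⟩
    · rintro (h | h)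
      · omega
      · exact ⟨by omega, by omega⟩

theorem rowLen_hook_zero {k m : ℕ} (hk : 1 ≤ k) : (hook k m hk).rowLen 0 = k := by
  have h : ∀ j, j < (hook k m hk).rowLen 0 ↔ j < k := fun j => by
    rw [← YoungDiagram.mem_iff_lt_rowLen, hook_mem_iff]
    omega
  have h1 := h k
  have h2 := h ((hook k m hk).rowLen 0)
  omega

theorem rowLen_hook_succ {k m : ℕ} (hk : 1 ≤ k) (i : ℕ) :
    (hook k m hk).rowLen (i + 1) = if i < m then 1 else 0 := by
  have h : ∀ j, j < (hook k m hk).rowLen (i + 1) ↔ i < m ∧ j = 0 := fun j => by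
    rw [← YoungDiagram.mem_iff_lt_rowLen, hook_mem_iff]
    omega
  have h0 := h 0
  have h1 := h 1
  split_ifs <;> omega

theorem card_hook {k m : ℕ} (hk : 1 ≤ k) : (hook k m hk).card = k + m := by
  rw [card_eq_sum_rowLen _ (M := m + 1), Finset.sum_range_succ', rowLen_hook_zero,
    Finset.sum_congr rfl fun i hi => by rw [rowLen_hook_succ, if_pos (Finset.mem_range.1 hi)]]
  · rw [Finset.sum_const, Finset.card_range, smul_eq_mul, mul_one, add_comm]
  · rw [← rowLen_eq_zero_iff, rowLen_hook_succ, if_neg (lt_irrefl m)]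

theorem eq_hook {μ : YoungDiagram} {k n : ℕ} (hk : 1 ≤ k) (hμ : μ.card = n)
    (h0 : μ.rowLen 0 = k) (h1 : ∀ i, 1 ≤ i → μ.rowLen i ≤ 1) : μ = hook k (n - k) hk := by
  have hpos : μ.colLen 0 ≠ 0 := fun h => by
    have := rowLen_eq_zero_iff.2 h.le
    omega
  have hrow : ∀ i, μ.rowLen (i + 1) = if i + 1 < μ.colLen 0 then 1 else 0 := by
    intro i
    have h2 := h1 (i + 1) (by omega)
    have h3 := rowLen_eq_zero_iff (μ := μ) (i := i + 1)
    split_ifs <;> omega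
  have hc := card_eq_sum_rowLen μ (M := μ.colLen 0 - 1 + 1) (by omega)
  rw [Finset.sum_range_succ', Finset.sum_congr rfl fun i hi => by
    rw [hrow, if_pos (by have := Finset.mem_range.1 hi; omega)], Finset.sum_const,
    Finset.card_range, smul_eq_mul, mul_one] at hc
  refine young_ext fun i => ?_
  cases i with
  | zero => rw [h0, rowLen_hook_zero]
  | succ i =>
    rw [hrow, rowLen_hook_succ]
    split_ifs <;> omega

-- When `n ≤ k` the truncated subtraction makes the second hook have `k + 1 > n` cells, so its term
-- vanishes, as it should.
open scoped Classical in
theorem hookIndicator_eq {μ : YoungDiagram} {k n : ℕ} (hk : 1 ≤ k) (hμ : μ.card = n) :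
    hookIndicator k μ = (if μ = hook k (n - k) hk then 1 else 0) +
      if μ = hook (k + 1) (n - (k + 1)) (by omega) then 1 else 0 := by
  have hle : ∀ p (hp : 1 ≤ p), ∀ i, 1 ≤ i → (hook p (n - p) hp).rowLen i ≤ 1 := by
    intro p hp i hi
    obtain ⟨i, rfl⟩ := Nat.exists_eq_add_of_le' hi
    rw [rowLen_hook_succ]
    split_ifs <;> omega
  by_cases h1 : μ = hook k (n - k) hk
  · have h0 : μ.rowLen 0 = k := by rw [h1, rowLen_hook_zero]
    rw [hookIndicator, if_pos ⟨h0.ge, by omega, by rw [h1]; exact hle k hk⟩, if_pos h1, if_neg]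
    · rfl
    · intro h2
      rw [h2, rowLen_hook_zero] at h0
      omega
  · rw [if_neg h1, zero_add]
    by_cases h2 : μ = hook (k + 1) (n - (k + 1)) (by omega)
    · have h0 : μ.rowLen 0 = k + 1 := by rw [h2, rowLen_hook_zero]
      rw [hookIndicator, if_pos ⟨by omega, h0.le, by rw [h2]; exact hle (k + 1) _⟩, if_pos h2]
    · rw [if_neg h2, hookIndicator, if_neg]
      rintro ⟨h3, h4, h5⟩
      rcases (by omega : μ.rowLen 0 = k ∨ μ.rowLen 0 = k + 1) with h | h
      · exact h1 (eq_hook hk hμ h h5)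
      · exact h2 (eq_hook _ hμ h h5)

/-! ### The Schur expansion of the chromatic symmetric function. -/

section Expansion

variable {V : Type*} [Fintype V] [DecidableEq V]

theorem isSchurExpansion_iff {G : SimpleGraph V} {c : YoungDiagram →₀ ℤ} :
    IsSchurExpansion (chromaticSymm G) c ↔ ∀ l, (graphSystem G).count Finset.univ l =
      ∑ μ ∈ c.support, c μ * youngSystem.count μ l := by
  simp only [← chromaticSymm_exponent, ← schur_exponent, ← sum_smul_schur_apply]
  constructor
  · intro h l
    exact congrFun h (exponent l)
  · intro h
    refine funext fun d => ?_
    obtain ⟨l, rfl⟩ := exists_exponent_eq d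
    exact h l

theorem existsUnique_isSchurExpansion (G : SimpleGraph V) :
    ∃! c : YoungDiagram →₀ ℤ, IsSchurExpansion (chromaticSymm G) c := by
  classical
  refine existsUnique_of_exists_of_unique ?_ ?_
  · obtain ⟨a, ha0, ha⟩ := exists_kostka_eq (Fintype.card V)
      fun ν => (graphSystem G).count Finset.univ ν.rowLens
    refine ⟨Finsupp.onFinset (diagrams (Fintype.card V)) a fun μ h => ?_,
      isSchurExpansion_iff.2 fun l => ?_⟩
    · by_contra hμ
      exact h (ha0 μ hμ)
    · rw [sum_support_eq]
      simp only [Finsupp.onFinset_apply]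
      by_cases hl : l.sum = Fintype.card V
      · obtain ⟨ν, hν, hp⟩ := exists_perm_rowLens l
        rw [(graphSystem G).count_eq_of_perm hp, ← ha ν (mem_diagrams.2 (hν.trans hl)), hl]
        exact Finset.sum_congr rfl fun μ _ => by rw [youngSystem.count_eq_of_perm hp]
      · rw [StripSystem.count_eq_zero _ fun h => hl h.symm]
        refine (Finset.sum_eq_zero fun μ hμ => ?_).symm
        rw [ha0 μ, zero_mul]
        rw [mem_diagrams] at hμ ⊢
        omega
  · intro c c' hc hc'
    rw [isSchurExpansion_iff] at hc hc'
    ext μ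
    refine kostka_injective μ.card (fun ν hν => ?_) (mem_diagrams.2 rfl)
    have h1 := hc ν.rowLens
    have h2 := hc' ν.rowLens
    rw [sum_support_eq, sum_rowLens, mem_diagrams.1 hν] at h1 h2
    exact h1.symm.trans h2

theorem coeff_eq_zero_of_card_ne {G : SimpleGraph V} {c : YoungDiagram →₀ ℤ}
    (hc : IsSchurExpansion (chromaticSymm G) c) {μ : YoungDiagram}
    (hμ : μ.card ≠ Fintype.card V) : c μ = 0 := by
  rw [isSchurExpansion_iff] at hc
  refine kostka_injective (a' := fun _ => 0) μ.card (fun ν hν => ?_) (mem_diagrams.2 rfl)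
  have h1 := hc ν.rowLens
  rw [sum_support_eq, sum_rowLens, mem_diagrams.1 hν, StripSystem.count_eq_zero] at h1
  · simpa using h1.symm
  · rw [sum_rowLens, mem_diagrams.1 hν]
    exact Ne.symm hμ

/-- The pairing of `X_G` with `e_(n-k) h_k`, computed once through sinks and once through the Schur
expansion. -/
theorem coeff_hook_add_coeff_hook {G : SimpleGraph V} {c : YoungDiagram →₀ ℤ}
    (hc : IsSchurExpansion (chromaticSymm G) c) {k : ℕ} (hk : 1 ≤ k) (hkn : k ≤ Fintype.card V) :
    c (hook k (Fintype.card V - k) hk) +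
      c (hook (k + 1) (Fintype.card V - (k + 1)) (by omega)) =
      ∑ j ∈ Finset.Icc 1 (Fintype.card V), (j.choose k : ℤ) * (numAcyclic G j : ℤ) := by
  classical
  rw [← sinkPairs_univ G hk, ← alternating_count_graph G (N := Fintype.card V - k) Finset.univ
    (by rw [Finset.card_univ]; omega)]
  simp only [isSchurExpansion_iff.1 hc]
  rw [alternating_sum c.support c _ fun μ l => youngSystem.count μ (l ++ [k])]
  have h1 : ∀ μ ∈ c.support, c μ * alternating (Fintype.card V - k)
      (fun l => youngSystem.count μ (l ++ [k])) =
      (if μ = hook k (Fintype.card V - k) hk then c μ else 0) +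
        if μ = hook (k + 1) (Fintype.card V - (k + 1)) (by omega) then c μ else 0 := by
    intro μ hμ
    have hcard : μ.card = Fintype.card V := by
      by_contra h
      exact Finsupp.mem_support_iff.1 hμ (coeff_eq_zero_of_card_ne hc h)
    rw [alternating_count_young μ (by omega), hookIndicator_eq hk hcard, mul_add]
    simp only [mul_ite, mul_one, mul_zero]
  rw [Finset.sum_congr rfl h1, Finset.sum_add_distrib, Finset.sum_ite_eq', Finset.sum_ite_eq']
  simp only [Finsupp.mem_support_iff, ite_not]
  congr 1
  all_goals split_ifs with h
  exacts [h, rfl, h, rfl]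

/-- Descending induction on `k`, with Pascal's rule `(j choose k) - (j-1 choose k) = (j-1 choose
k-1)`. At the start `k = n + 1` both sides vanish: the hook has `n + 1` cells, and `j - 1 < n`. -/
theorem coeff_hook_eq {G : SimpleGraph V} {c : YoungDiagram →₀ ℤ}
    (hc : IsSchurExpansion (chromaticSymm G) c) {k : ℕ} (hk : 1 ≤ k)
    (hkn : k ≤ Fintype.card V + 1) :
    c (hook k (Fintype.card V - k) hk) = ∑ j ∈ Finset.Icc 1 (Fintype.card V),
      ((j - 1).choose (k - 1) : ℤ) * (numAcyclic G j : ℤ) := by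
  induction hkn using Nat.decreasingInduction with
  | self =>
    rw [coeff_eq_zero_of_card_ne hc (by rw [card_hook]; omega)]
    refine (Finset.sum_eq_zero fun j hj => ?_).symm
    rw [Finset.mem_Icc] at hj
    rw [Nat.choose_eq_zero_of_lt (by omega)]
    simp
  | of_succ k hkn ih =>
    have h := coeff_hook_add_coeff_hook hc hk (by omega)
    rw [ih (by omega), ← eq_sub_iff_add_eq, ← Finset.sum_sub_distrib] at h
    rw [h]
    refine Finset.sum_congr rfl fun j hj => ?_
    obtain ⟨j, rfl⟩ := Nat.exists_eq_add_of_le' (Finset.mem_Icc.1 hj).1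
    obtain ⟨k, rfl⟩ := Nat.exists_eq_add_of_le' hk
    simp only [Nat.add_sub_cancel, Nat.choose_succ_succ, Nat.cast_add, Nat.succ_eq_add_one]
    ring

end Expansion

end

end ChromaticHook

theorem theorem1 {V : Type*} [Fintype V] (G : SimpleGraph V) :
    (∃! c : YoungDiagram →₀ ℤ, ChromaticHook.IsSchurExpansion (ChromaticHook.chromaticSymm G) c) ∧
    ∀ c : YoungDiagram →₀ ℤ, ChromaticHook.IsSchurExpansion (ChromaticHook.chromaticSymm G) c →
      (∀ (k : ℕ) (hk : 1 ≤ k), k ≤ Fintype.card V →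
        c (ChromaticHook.hook k (Fintype.card V - k) hk) =
          ∑ j ∈ Finset.Icc 1 (Fintype.card V),
            ((j - 1).choose (k - 1) : ℤ) * (ChromaticHook.numAcyclic G j : ℤ)) ∧
      (∀ (k m : ℕ) (hk : 1 ≤ k), 0 ≤ c (ChromaticHook.hook k m hk)) := by
  classical
  refine ⟨ChromaticHook.existsUnique_isSchurExpansion G, fun c hc =>
    ⟨fun k hk hkn => ChromaticHook.coeff_hook_eq hc hk (by omega), fun k m hk => ?_⟩⟩
  by_cases h : k + m = Fintype.card V
  · obtain rfl : m = Fintype.card V - k := by omega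
    rw [ChromaticHook.coeff_hook_eq hc hk (by omega)]
    exact Finset.sum_nonneg fun j _ => by positivity
  · rw [ChromaticHook.coeff_eq_zero_of_card_ne hc (by rwa [ChromaticHook.card_hook])]
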